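/- Identify $T^*\mathbb{R}$ with $\mathbb{C}$ by $(x,y)\mapsto x+iy$ and $p\in\mathbb{R}$ with the point $(p,0)$ of the zero section; indices are taken modulo $3$. Let $L_1,L_2,L_3\subset T^*\mathbb{R}$ be affine Lagrangian sections (non-vertical straight lines) with $L_i\cap L_j\neq\emptyset$ for $i\neq j$ and $L_i\neq L_{i+1}$, and let $f_1,f_2,f_3:\mathbb{R}\to\mathbb{R}$ be differentiable functions with $L_i=\operatorname{graph}(df_i)$. Let $x_i$ be the intersection point of $L_i$ and $L_{i+1}$ and $p_i$ its projection to $\mathbb{R}$, and assume that $x_1,x_2,x_3$ are the distinct vertices, in counterclockwise order, of a triangle. A gradient tree is a continuous map $I:T\to\mathbb{R}$, where $T$ is the tree obtained from three edges $e_1,e_2,e_3$, each a copy of $[-\infty,0]$, by gluing them at the common end point $0$ (the interior vertex), such that $I$ maps the external vertex $-\infty$ of $e_i$ to $p_i$, and $I_i=I|_{e_i}$ satisfies $\frac{dI_i}{dt}=-\operatorname{grad}(f_{i+1}-f_i)(I_i)$ on $(-\infty,0]$ for $i=1,2,3$. For $\epsilon>0$ let $L_i^\epsilon=\operatorname{graph}(\epsilon\,df_i)$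 and $x_i^\epsilon\in L_i^\epsilon\cap L_{i+1}^\epsilon$. Let $z_1=1$, $z_2=\infty$, $z_3=0$. Let $w_\epsilon$ be the Schwarz–Christoffel map from the upper half plane to the triangle $x_1^\epsilon x_2^\epsilon x_3^\epsilon$ with $w_\epsilon(z_i)=x_i^\epsilon$, that is, $w_\epsilon$ is continuous on $\overline{\mathbb{H}}\cup\{\infty\}$, maps $\mathbb{H}$ holomorphically and bijectively onto the interior of the triangle, satisfies $w_\epsilon(z_i)=x_i^\epsilon$, and maps the boundary arcs $(0,1)$, $(1,\infty)$, $(-\infty,0)$ into $L_1^\epsilon$, $L_2^\epsilon$, $L_3^\epsilon$ respectively. For $\delta>0$ put $D_p(\delta)=\{z: \operatorname{Im}z\ge0,\ |z-p|<\delta\}$ and $\phi_{p,\delta}(\tau,\sigma)=p+\delta e^{\pi(\tau+i\sigma)}$ for $p\in\mathbb{R}$, $D_\infty(\delta)=\{z:\operatorname{Im}z\ge0,\ |z|^{-1}<\delta\}$ (with the convention $|0|^{-1}=+\infty$) and $\phi_{\infty,\delta}(\tau,\sigma)=-\delta^{-1}e^{-\pi(\tau+i\sigma)}$. Put $\Theta_{ext}=(-\infty,0)\times[0,1]$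 and $D(\delta)=\overline{\mathbb{H}}\setminus\bigcup_{i=1}^3D_{z_i}(\delta)$. **Theorem.** There is exactly one real number $p_0$ that is a critical point of Morse index $0$ of one of the functions $f_2-f_1$, $f_3-f_2$, $f_1-f_3$. There is exactly one gradient tree $I$, and it maps the interior vertex to $p_0$, i.e. $I_i(0)=p_0$ for $i=1,2,3$. If $\delta>0$ is such that $D_{z_i}(\delta)\cap D_{z_j}(\delta)=\emptyset$ for $i\neq j$, then $$\lim_{\epsilon\to+0}\ \sup_{z\in D(\delta)}\left|w_\epsilon(z)-p_0\right|=0$$ and, for $i=1,2,3$, $$\lim_{\epsilon\to+0}\ \sup_{(\tau,\sigma)\in\Theta_{ext}}\left|w_\epsilon\circ\phi_{z_i,\delta}(\tau,\sigma)-I_i(\epsilon\tau)\right|=0 .$$ -/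

import Mathlib

open Filter Topology
open scoped OnePoint

noncomputable section

namespace TriangleDisk

/-! The indices 1, 2, 3 are the elements 0, 1, 2 of `Fin 3`, and `i + 1` is cyclic.
The cotangent bundle `T*ℝ` is identified with `ℂ` by `(x, y) ↦ x + i y`; its zero section is then
the real axis, so that `p : ℝ` is identified with `(p : ℂ)`. -/

/-- The graph in `T*ℝ = ℂ` of the one-form `η dx` on `ℝ`. -/
def graphOneForm (η : ℝ → ℝ) : Set ℂ := {z | z.im = η z.re}

/-- An affine Lagrangian section of `T*ℝ`: a non-vertical straight line. -/
def IsAffineSection (L : Set ℂ) : Prop :=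
  ∃ a b : ℝ, L = graphOneForm (fun t => a * t + b)

/-- `x 0`, `x 1`, `x 2` are the vertices, in counterclockwise order, of a
(non-degenerate) triangle: the signed area is positive. -/
def IsCounterclockwise (x : Fin 3 → ℂ) : Prop :=
  0 < (x 1 - x 0).re * (x 2 - x 0).im - (x 1 - x 0).im * (x 2 - x 0).re

/-! ### Morse theory on the real line -/

/-- The Morse index at `p`: the number of negative eigenvalues of the Hessian, which on the
line is the `1 × 1` matrix `(g''(p))`. -/
def morseIndex (g : ℝ → ℝ) (p : ℝ) : ℕ :=
  if deriv (deriv g) p < 0 then 1 else 0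

/-- `p` is a critical point of Morse index zero of one of the functions
`f (i + 1) - f i`. -/
def IsIndexZeroCriticalPoint (f : Fin 3 → ℝ → ℝ) (p : ℝ) : Prop :=
  ∃ i : Fin 3, deriv (fun t => f (i + 1) t - f i t) p = 0 ∧
    morseIndex (fun t => f (i + 1) t - f i t) p = 0

/-! ### Gradient trees with three external vertices

A metric ribbon tree with three external vertices has exactly one interior vertex and no interior
edge: it is the tripod, i.e. three copies `[-∞, 0]` of the external edge (the external vertex
sits at `-∞`, and the edge without it is isometric to `(-∞, 0]`) glued at `0`. -/

/-- The endpoints `0` of the three edges `[-∞, 0]` are identified with each other. -/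
def tripodSetoid : Setoid (Fin 3 × Set.Iic (0 : EReal)) where
  r a b := a = b ∨ ((a.2 : EReal) = 0 ∧ (b.2 : EReal) = 0)
  iseqv :=
    { refl := fun _ => Or.inl rfl
      symm := by
        rintro a b (h | ⟨h, h'⟩)
        · exact Or.inl h.symm
        · exact Or.inr ⟨h', h⟩
      trans := by
        rintro a b c (rfl | ⟨h, h'⟩) (rfl | ⟨k, k'⟩)
        · exact Or.inl rfl
        · exact Or.inr ⟨k, k'⟩
        · exact Or.inr ⟨h, h'⟩
        · exact Or.inr ⟨h, k'⟩ }

/-- The tree with three external edges and one interior vertex, external vertices included. -/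
def Tripod : Type := Quotient tripodSetoid

/-- The quotient topology. -/
instance : TopologicalSpace Tripod :=
  inferInstanceAs (TopologicalSpace (Quotient tripodSetoid))

namespace Tripod

/-- The `i`-th external vertex `v i`. -/
def vertex (i : Fin 3) : Tripod :=
  Quotient.mk tripodSetoid (i, ⟨⊥, Set.mem_Iic.2 bot_le⟩)

/-- The point with parameter `t ∈ (-∞, 0]` on the `i`-th external edge. (Parameters `t > 0`, which
are never used, are sent to the interior vertex.) -/
def edge (i : Fin 3) (t : ℝ) : Tripod :=
  Quotient.mk tripodSetoid (i, ⟨min (t : EReal) 0, Set.mem_Iic.2 (min_le_right _ _)⟩)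

/-- The interior vertex, the common endpoint `t = 0` of the three edges. -/
def center : Tripod := edge 0 0

end Tripod

/-- `I : T → ℝ` is a gradient tree for `f` with ends `p`: it is continuous, maps the external
vertex `v i` to `p i`, and on the external edge `e i ≃ (-∞, 0]` it is a solution of
`dI/dt = - grad (f (i + 1) - f i)`. -/
structure IsGradientTree (f : Fin 3 → ℝ → ℝ) (p : Fin 3 → ℝ) (I : Tripod → ℝ) : Prop where
  continuous : Continuous I
  map_vertex : ∀ i, I (Tripod.vertex i) = p i
  flow : ∀ i, ∀ t ≤ (0 : ℝ),
    HasDerivWithinAt (fun s => I (Tripod.edge i s))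
      (-deriv (fun u => f (i + 1) u - f i u) (I (Tripod.edge i t))) (Set.Iic 0) t

/-! ### Holomorphic disks on the upper half plane -/

/-- The open upper half plane. -/
def openHalfPlane : Set ℂ := {z | 0 < z.im}

/-- The closed upper half plane (its finite points). -/
def closedHalfPlane : Set ℂ := {z | 0 ≤ z.im}

/-- The marked points `1, ∞, 0` on the boundary `ℝ ∪ {∞}` of the upper half plane. -/
def markedPoint : Fin 3 → OnePoint ℝ := ![((1 : ℝ) : OnePoint ℝ), ∞, ((0 : ℝ) : OnePoint ℝ)]

/-- `w` is a holomorphic disk, parametrized by the closed upper half plane with marked points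
`1, ∞, 0`: it is continuous on the closed half plane including `∞`, holomorphic inside,
maps the marked points to `x 0, x 1, x 2`, and maps the boundary arcs
`(0, 1)`, `(1, ∞)`, `(-∞, 0)` into `L 0`, `L 1`, `L 2`. -/
structure IsHolomorphicDisk (L : Fin 3 → Set ℂ) (x : Fin 3 → ℂ) (w : ℂ → ℂ) : Prop where
  continuousOn : ContinuousOn w closedHalfPlane
  holomorphic : DifferentiableOn ℂ w openHalfPlane
  map_one : w 1 = x 0
  map_infty : Tendsto w (Bornology.cobounded ℂ ⊓ 𝓟 closedHalfPlane) (𝓝 (x 1))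
  map_zero : w 0 = x 2
  boundary_zero : ∀ t : ℝ, 0 < t → t < 1 → w t ∈ L 0
  boundary_one : ∀ t : ℝ, 1 < t → w t ∈ L 1
  boundary_two : ∀ t : ℝ, t < 0 → w t ∈ L 2

/-- `w` is the Schwarz-Christoffel map from the upper half plane onto the triangle with vertices
`x 0, x 1, x 2` and edges on `L 0, L 1, L 2`: a holomorphic disk which maps the open half plane
conformally (holomorphically and bijectively) onto the interior of the triangle. -/
structure IsSchwarzChristoffelMap (L : Fin 3 → Set ℂ) (x : Fin 3 → ℂ) (w : ℂ → ℂ) : Prop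
    extends IsHolomorphicDisk L x w where
  bijOn : Set.BijOn w openHalfPlane (interior (convexHull ℝ (Set.range x)))

/-! ### The decomposition of the half plane -/

/-- The half disk `D_p(δ)` around a boundary point `p ∈ ℝ ∪ {∞}` (its finite points); for
`p = ∞` it is given by `|z|⁻¹ < δ`, written as `δ⁻¹ < |z|`. -/
def halfDisk : OnePoint ℝ → ℝ → Set ℂ
  | (p : ℝ), δ => {z | 0 ≤ z.im ∧ ‖z - (p : ℂ)‖ < δ}
  | ∞, δ => {z | 0 ≤ z.im ∧ δ⁻¹ < ‖z‖}

/-- The strip chart `φ_{p,δ}(τ, σ)`. -/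
def stripChart : OnePoint ℝ → ℝ → ℝ × ℝ → ℂ
  | (p : ℝ), δ, (τ, σ) => (p : ℂ) + (δ : ℂ) * Complex.exp (Real.pi * (τ + Complex.I * σ))
  | ∞, δ, (τ, σ) => -(δ : ℂ)⁻¹ * Complex.exp (-Real.pi * (τ + Complex.I * σ))

/-- The strip `(-∞, 0) × [0, 1]`. -/
def strip : Set (ℝ × ℝ) := Set.Iio 0 ×ˢ Set.Icc 0 1

/-- The complement `D(δ)` in the closed half plane of the neighbourhoods of the marked points. -/
def thickPart (δ : ℝ) : Set ℂ := closedHalfPlane \ ⋃ i, halfDisk (markedPoint i) δ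

end TriangleDisk

end

/-!
The Schwarz–Christoffel maps are not computed. All that is used about `w = w_ε` is that it is
holomorphic, that its boundary arcs lie on the lines `y = ε (a i x + b i)`, and that its values lie
in a triangle of height `O(ε)` (`IsThinDisk`).

*Gradient estimate.* After multiplication by a constant, the imaginary part of `w` is `O(ε)` and
vanishes on a boundary arc. Comparison with an explicit harmonic barrier on half disks, followed by
Cauchy's estimate, bounds `w'` up to the boundary: `|w'(z)| ≤ K ε / min (|z|, |z - 1|)`
(`exists_norm_deriv_le`). Hence `w` varies by `O(ε)` on the thick part and along each cross section
of the three strips.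

*Averages.* On a strip, let `A(τ)` be the average of `Re w` over the cross section at `τ`. By
Cauchy's theorem on rectangles, `A'` is the difference of the values of `Im w` at the two boundary
points, which are affine functions of `Re w` there. As `Re w = A + O(ε)`, this gives
`A' = -ε l i (A - p i) + O(ε²)`, where `l i = a (i + 1) - a i`: the gradient flow of
`f (i + 1) - f i`, slowed down by `ε` (`exists_end_average`).

*Comparison.* The triangle being counterclockwise, `l i` is positive for exactly one index `m`,
namely that of the vertex whose abscissa lies between the two others
(`exists_pos_slope_difference`), and `p m` is the point `p₀`. For `l m > 0`, the only backward
trajectories that stay bounded are close to the rest point `p m`, so that `w` is close to `p m` on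
the whole `m`-th strip, and then on the thick part. On the other two strips the flow contracts in
backward time, so the initial value `p m + O(ε)` determines `A` up to `O(ε)`
(`exists_convergence_rate`). The same two comparison lemmas `abs_le_div_of_flow` and
`abs_le_abs_zero_add_of_flow`, with error `0`, prove the uniqueness of the gradient tree.
-/

namespace TriangleDisk

/-! ### Gradient estimates for holomorphic functions with small imaginary part -/

theorem openHalfPlane_subset_closedHalfPlane : openHalfPlane ⊆ closedHalfPlane :=
  fun z (hz : 0 < z.im) => (hz.le : 0 ≤ z.im)

/-- A Borel–Carathéodory type estimate: the derivative is controlled by the imaginary part alone.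
It is Cauchy's estimate for `exp (i f / M)`, whose modulus lies between `e⁻¹` and `e`. -/
theorem norm_deriv_le_of_abs_im_le {f : ℂ → ℂ} {c : ℂ} {R M : ℝ} (hR : 0 < R) (hM : 0 < M)
    (hd : DifferentiableOn ℂ f (Metric.ball c R))
    (hb : ∀ z ∈ Metric.ball c R, |(f z).im| ≤ M) :
    ‖deriv f c‖ ≤ 2 * Real.exp 2 * M / R := by
  set g : ℂ → ℂ := fun z => Complex.exp (Complex.I * f z / M) with hg
  have hre : ∀ z, (Complex.I * f z / M).re = -(f z).im / M := by
    intro z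
    rw [Complex.div_ofReal_re]
    simp
  have hgd : DifferentiableOn ℂ g (Metric.ball c R) :=
    ((hd.const_mul _).div_const _).cexp
  have hcR : c ∈ Metric.ball c R := Metric.mem_ball_self hR
  have hsub : Metric.closedBall c (R / 2) ⊆ Metric.ball c R :=
    Metric.closedBall_subset_ball (by linarith)
  have hcl : DiffContOnCl ℂ g (Metric.ball c (R / 2)) :=
    (hgd.mono (by rw [closure_ball c (by positivity)]; exact hsub)).diffContOnCl
  have hgb : ∀ z ∈ Metric.sphere c (R / 2), ‖g z‖ ≤ Real.exp 1 := by
    intro z hz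
    have := hb z (hsub (Metric.sphere_subset_closedBall hz))
    rw [hg, Complex.norm_exp, hre, Real.exp_le_exp, div_le_one hM]
    linarith [neg_abs_le (f z).im]
  have h1 := Complex.norm_deriv_le_of_forall_mem_sphere_norm_le (by positivity) hcl hgb
  have hfd : DifferentiableAt ℂ f c := hd.differentiableAt (Metric.isOpen_ball.mem_nhds hcR)
  have h2 : deriv g c = g c * (Complex.I * deriv f c / M) :=
    ((hfd.hasDerivAt.const_mul Complex.I).div_const (M : ℂ)).cexp.deriv
  have h3 : Real.exp (-1) ≤ ‖g c‖ := by
    have := hb c hcR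
    rw [hg, Complex.norm_exp, hre, Real.exp_le_exp, le_div_iff₀ hM]
    linarith [le_abs_self (f c).im]
  rw [h2, norm_mul, norm_div, norm_mul, Complex.norm_I, one_mul, Complex.norm_real,
    Real.norm_of_nonneg hM.le] at h1
  have h4 : Real.exp (-1) * (‖deriv f c‖ / M) ≤ Real.exp 1 / (R / 2) :=
    (mul_le_mul_of_nonneg_right h3 (by positivity)).trans h1
  have h5 : Real.exp 1 * Real.exp (-1) = 1 := by rw [← Real.exp_add]; simp
  have h6 : Real.exp 1 * Real.exp 1 = Real.exp 2 := by rw [← Real.exp_add]; norm_num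
  calc ‖deriv f c‖ = Real.exp 1 * (Real.exp (-1) * (‖deriv f c‖ / M)) * M := by
        rw [← mul_assoc, h5, one_mul, div_mul_cancel₀ _ hM.ne']
    _ ≤ Real.exp 1 * (Real.exp 1 / (R / 2)) * M := by gcongr
    _ = 2 * (Real.exp 1 * Real.exp 1) * M / R := by field_simp
    _ = _ := by rw [h6]

/-- If the imaginary part of `f` vanishes on the diameter of a half disk, then it is at most
linear in the distance to the diameter, on the axis of the half disk. The harmonic barrier is
`Im (i ζ² + 2 ζ) = ξ² - η² + 2 η`, which is at least `1` on the unit half circle. -/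
theorem im_le_of_im_eq_zero_on_diameter {f : ℂ → ℂ} {x r M : ℝ} (hr : 0 < r) (hM : 0 < M)
    (hc : ContinuousOn f closedHalfPlane) (hd : DifferentiableOn ℂ f openHalfPlane)
    (h0 : ∀ t : ℝ, |t - x| ≤ r → (f t).im = 0)
    (hb : ∀ z ∈ closedHalfPlane, (f z).im ≤ M) {y : ℝ} (hy : 0 ≤ y) (hyr : y ≤ r) :
    (f ⟨x, y⟩).im ≤ 2 * M * y / r := by
  -- The maximum principle for `Im f / M` minus the barrier is applied in the form of the maximum
  -- modulus principle for `F`.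
  set ζ : ℂ → ℂ := fun z => (z - x) / r with hζ
  set F : ℂ → ℂ := fun z =>
    Complex.exp (-Complex.I * (f z / M - (Complex.I * ζ z ^ 2 + 2 * ζ z))) with hF
  have hζre : ∀ z, (ζ z).re = (z.re - x) / r := fun z => by
    rw [hζ, Complex.div_ofReal_re]; simp
  have hζim : ∀ z, (ζ z).im = z.im / r := fun z => by
    rw [hζ, Complex.div_ofReal_im]; simp
  have hre : ∀ z, (-Complex.I * (f z / M - (Complex.I * ζ z ^ 2 + 2 * ζ z))).re =
      (f z).im / M - ((ζ z).re ^ 2 - (ζ z).im ^ 2 + 2 * (ζ z).im) := by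
    intro z
    have : (f z / M).im = (f z).im / M := Complex.div_ofReal_im _ _
    simp [pow_two, this]
  set U : Set ℂ := Metric.ball (x : ℂ) r ∩ openHalfPlane with hU
  have hop : IsOpen openHalfPlane := isOpen_lt continuous_const Complex.continuous_im
  have hcp : IsClosed closedHalfPlane := isClosed_le continuous_const Complex.continuous_im
  have hUo : IsOpen U := Metric.isOpen_ball.inter hop
  have hclU : closure U ⊆ Metric.closedBall (x : ℂ) r ∩ closedHalfPlane :=
    closure_minimal (Set.inter_subset_inter Metric.ball_subset_closedBall
      openHalfPlane_subset_closedHalfPlane)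
      (Metric.isClosed_closedBall.inter hcp)
  have hζd : Differentiable ℂ ζ := (differentiable_id.sub_const _).div_const _
  have hbar : Differentiable ℂ fun z => Complex.I * ζ z ^ 2 + 2 * ζ z :=
    ((hζd.pow 2).const_mul _).add (hζd.const_mul _)
  have hFd : DiffContOnCl ℂ F U := by
    constructor
    · exact ((((hd.mono Set.inter_subset_right).div_const _).sub
        hbar.differentiableOn).const_mul _).cexp
    · exact Complex.continuous_exp.comp_continuousOn
        ((((hc.mono (hclU.trans Set.inter_subset_right)).div_const _).sub
          hbar.continuous.continuousOn).const_mul _)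
  have key : ∀ z ∈ frontier U, ‖F z‖ ≤ 1 := by
    intro z hz
    rw [frontier, hUo.interior_eq] at hz
    obtain ⟨hz1, hz2⟩ := hz
    obtain ⟨hzb, hzi⟩ := hclU hz1
    have hzi' : 0 ≤ z.im := hzi
    rw [hF, Complex.norm_exp, Real.exp_le_one_iff, hre, sub_nonpos]
    rcases hzi'.eq_or_lt with h | h
    · have hzx : z = (z.re : ℂ) := Complex.ext rfl (by simp [← h])
      have h1 : |z.re - x| ≤ r := by
        rw [hzx, Metric.mem_closedBall, dist_eq_norm, ← Complex.ofReal_sub, Complex.norm_real,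
          Real.norm_eq_abs] at hzb
        exact hzb
      have h2 : (f z).im = 0 := by rw [hzx]; exact h0 _ h1
      rw [h2, hζim, ← h]
      simp only [zero_div]
      nlinarith [sq_nonneg (ζ z).re]
    · have h3 : dist z x = r := by
        refine le_antisymm hzb (not_lt.1 fun hlt => hz2 ⟨hlt, h⟩)
      have h4 : (z.re - x) ^ 2 + z.im ^ 2 = r ^ 2 := by
        rw [← h3, dist_eq_norm, ← Complex.normSq_eq_norm_sq, Complex.normSq_apply]
        simp; ring
      have h5 : (ζ z).re ^ 2 + (ζ z).im ^ 2 = 1 := by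
        rw [hζre, hζim, div_pow, div_pow, ← add_div, h4, div_self (by positivity)]
      have h6 : 0 ≤ (ζ z).im := by rw [hζim]; positivity
      have h7 : (f z).im / M ≤ 1 := (div_le_one hM).2 (hb z hzi)
      nlinarith [sq_nonneg (ζ z).re]
  have hmem : (⟨x, y⟩ : ℂ) ∈ closure U := by
    have hcont : Continuous fun s : ℝ => (⟨x, s⟩ : ℂ) := by
      have : (fun s : ℝ => (⟨x, s⟩ : ℂ)) = fun s : ℝ => (x : ℂ) + s * Complex.I := by
        ext s; simp [Complex.ext_iff]
      rw [this]; fun_prop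
    have h1 : Set.MapsTo (fun s : ℝ => (⟨x, s⟩ : ℂ)) (Set.Ioo 0 r) U := by
      intro s hs
      refine ⟨?_, hs.1⟩
      have : (⟨x, s⟩ : ℂ) - x = s * Complex.I := by simp [Complex.ext_iff]
      rw [Metric.mem_ball, dist_eq_norm, this, norm_mul, Complex.norm_I, mul_one, Complex.norm_real,
        Real.norm_of_nonneg hs.1.le]
      exact hs.2
    have h2 := h1.closure hcont
    rw [closure_Ioo hr.ne] at h2
    exact h2 ⟨hy, hyr⟩
  have hfin := Complex.norm_le_of_forall_mem_frontier_norm_le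
    (Metric.isBounded_ball.subset Set.inter_subset_left) hFd key hmem
  rw [hF, Complex.norm_exp, Real.exp_le_one_iff, hre, hζre, hζim, sub_nonpos] at hfin
  simp only [sub_self, zero_div] at hfin
  have h8 : (f ⟨x, y⟩).im / M ≤ 2 * (y / r) := by nlinarith [sq_nonneg (y / r)]
  rw [div_le_iff₀ hM] at h8
  calc _ ≤ _ := h8
    _ = _ := by ring

theorem abs_im_le_of_im_eq_zero_on_diameter {f : ℂ → ℂ} {x r M : ℝ} (hr : 0 < r) (hM : 0 < M)
    (hc : ContinuousOn f closedHalfPlane) (hd : DifferentiableOn ℂ f openHalfPlane)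
    (h0 : ∀ t : ℝ, |t - x| ≤ r → (f t).im = 0)
    (hb : ∀ z ∈ closedHalfPlane, |(f z).im| ≤ M) {y : ℝ} (hy : 0 ≤ y) (hyr : y ≤ r) :
    |(f ⟨x, y⟩).im| ≤ 2 * M * y / r := by
  refine abs_le.2 ⟨?_, im_le_of_im_eq_zero_on_diameter hr hM hc hd h0
    (fun z hz => (abs_le.1 (hb z hz)).2) hy hyr⟩
  have := im_le_of_im_eq_zero_on_diameter (f := fun z => -f z) (x := x) hr hM hc.neg hd.neg
    (fun t ht => by simp [h0 t ht])
    (fun z hz => by simpa using neg_le.1 (abs_le.1 (hb z hz)).1) hy hyr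
  simp only [Complex.neg_im] at this
  linarith

/-- The derivative estimate, uniform up to the boundary: near a boundary interval on which `Im f`
vanishes, `Im f` is linearly small, which compensates for the smallness of the balls available. -/
theorem norm_deriv_le_of_im_eq_zero_on_interval {f : ℂ → ℂ} {M d : ℝ} (hM : 0 < M) (hd0 : 0 < d)
    (hc : ContinuousOn f closedHalfPlane) (hd : DifferentiableOn ℂ f openHalfPlane)
    (hb : ∀ z ∈ closedHalfPlane, |(f z).im| ≤ M) {z : ℂ} (hz : z ∈ openHalfPlane)
    (h0 : ∀ t : ℝ, |t - z.re| < d → (f t).im = 0) :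
    ‖deriv f z‖ ≤ 24 * Real.exp 2 * M / d := by
  have hz' : 0 < z.im := hz
  have hball : ∀ {R : ℝ}, ∀ u ∈ Metric.ball z R, |u.re - z.re| < R ∧ |u.im - z.im| < R := by
    intro R u hu
    rw [Metric.mem_ball, dist_eq_norm] at hu
    exact ⟨(Complex.abs_re_le_norm (u - z)).trans_lt hu, (Complex.abs_im_le_norm (u - z)).trans_lt hu⟩
  rcases le_or_gt (d / 4) z.im with h | h
  · have hsub : Metric.ball z (d / 4) ⊆ openHalfPlane := by
      intro u hu
      have := (abs_lt.1 (hball u hu).2).1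
      show 0 < u.im
      linarith
    refine (norm_deriv_le_of_abs_im_le (R := d / 4) (by positivity) hM (hd.mono hsub)
      fun u hu => hb u (openHalfPlane_subset_closedHalfPlane (hsub hu))).trans ?_
    rw [div_le_div_iff₀ (by positivity) hd0]
    nlinarith [mul_pos (mul_pos (Real.exp_pos 2) hM) hd0]
  · have hsub : Metric.ball z (z.im / 2) ⊆ openHalfPlane := by
      intro u hu
      have := (abs_lt.1 (hball u hu).2).1
      show 0 < u.im
      linarith
    have hM' : 0 < 6 * M * z.im / d := by positivity
    refine (norm_deriv_le_of_abs_im_le (R := z.im / 2) (by positivity) hM' (hd.mono hsub)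
      fun u hu => ?_).trans ?_
    · have hu0 : 0 < u.im := hsub hu
      obtain ⟨h1, h2⟩ := hball u hu
      rw [abs_lt] at h1 h2
      have h3 := abs_im_le_of_im_eq_zero_on_diameter (x := u.re) (r := d / 2) (by positivity) hM
        hc hd (fun t ht => h0 t (by rw [abs_le] at ht; rw [abs_lt]; constructor <;> linarith)) hb
        hu0.le (by linarith)
      refine h3.trans ?_
      rw [div_le_div_iff₀ (by positivity) hd0]
      nlinarith [mul_pos hM hd0]
    · apply le_of_eq
      field_simp
      ring

/-- The mean value inequality for a path that is differentiable in the interior of its interval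
only. -/
theorem norm_sub_le_of_norm_deriv_le_Ioo {g g' : ℝ → ℂ} {a b C : ℝ} (hab : a ≤ b)
    (hg : ContinuousOn g (Set.Icc a b)) (hg' : ∀ t ∈ Set.Ioo a b, HasDerivAt g (g' t) t)
    (hC : ∀ t ∈ Set.Ioo a b, ‖g' t‖ ≤ C) : ‖g b - g a‖ ≤ C * (b - a) := by
  rcases hab.eq_or_lt with rfl | hab
  · simp
  have h1 : ∀ t ∈ Set.Ioo a b, ‖g b - g t‖ ≤ C * (b - t) := by
    intro t ht
    refine norm_image_sub_le_of_norm_deriv_right_le_segment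
      (hg.mono (Set.Icc_subset_Icc_left ht.1.le))
      (fun s hs => (hg' s ⟨ht.1.trans_le hs.1, hs.2⟩).hasDerivWithinAt)
      (fun s hs => hC s ⟨ht.1.trans_le hs.1, hs.2⟩) b ⟨ht.2.le, le_rfl⟩
  have h2 : Tendsto g (𝓝[>] a) (𝓝 (g a)) :=
    ((hg a ⟨le_rfl, hab.le⟩).mono Set.Ioo_subset_Icc_self).mono_left
      (by rw [nhdsWithin_Ioo_eq_nhdsGT hab])
  have h3 : Tendsto (fun t => C * (b - t)) (𝓝[>] a) (𝓝 (C * (b - a))) :=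
    ((continuous_const.mul (continuous_const.sub continuous_id)).tendsto a).mono_left
      nhdsWithin_le_nhds
  exact le_of_tendsto_of_tendsto (tendsto_const_nhds.sub h2).norm h3
    (by filter_upwards [Ioo_mem_nhdsGT hab] with t ht using h1 t ht)

/-! ### Perturbed linear flows on the negative half line -/

theorem antitoneOn_exp_mul_sub_div {D D' : ℝ → ℝ} {k e : ℝ} (hk : k ≠ 0)
    (hc : ContinuousOn D (Set.Iic 0)) (hD : ∀ t < 0, HasDerivAt D (D' t) t)
    (hb : ∀ t < 0, D' t + k * D t ≤ e) :
    AntitoneOn (fun t => Real.exp (k * t) * (D t - e / k)) (Set.Iic 0) := by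
  have hder : ∀ t < 0, HasDerivAt (fun t => Real.exp (k * t) * (D t - e / k))
      (Real.exp (k * t) * (D' t + k * D t - e)) t := by
    intro t ht
    have h1 : HasDerivAt (fun t => Real.exp (k * t)) (Real.exp (k * t) * (k * 1)) t :=
      ((hasDerivAt_id t).const_mul k).exp
    have h2 : k * (e / k) = e := mul_div_cancel₀ e hk
    refine (h1.mul ((hD t ht).sub_const (e / k))).congr_deriv ?_
    linear_combination -Real.exp (k * t) * h2
  refine antitoneOn_of_deriv_nonpos (convex_Iic 0)
    ((by fun_prop : Continuous fun t => Real.exp (k * t)).continuousOn.mul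
      (hc.sub continuousOn_const)) ?_ ?_
  · rw [interior_Iic]
    exact fun t ht => (hder t ht).differentiableAt.differentiableWithinAt
  · rw [interior_Iic]
    intro t ht
    rw [(hder t ht).deriv]
    exact mul_nonpos_of_nonneg_of_nonpos (Real.exp_pos _).le (by linarith [hb t ht])

theorem le_div_of_flow_le {D D' : ℝ → ℝ} {k e : ℝ} (hk : 0 < k)
    (hc : ContinuousOn D (Set.Iic 0)) (hD : ∀ t < 0, HasDerivAt D (D' t) t)
    (hb : ∀ t < 0, D' t + k * D t ≤ e)
    (hlim : Tendsto (fun t => Real.exp (k * t) * D t) atBot (𝓝 0)) {t : ℝ} (ht : t ≤ 0) :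
    D t ≤ e / k := by
  have hanti := antitoneOn_exp_mul_sub_div hk.ne' hc hD hb
  have hexp : Tendsto (fun t : ℝ => Real.exp (k * t)) atBot (𝓝 0) :=
    Real.tendsto_exp_atBot.comp (tendsto_id.const_mul_atBot hk)
  have hG : Tendsto (fun t => Real.exp (k * t) * (D t - e / k)) atBot (𝓝 0) := by
    simpa [mul_sub] using hlim.sub (hexp.mul_const (e / k))
  have h1 : Real.exp (k * t) * (D t - e / k) ≤ 0 :=
    ge_of_tendsto hG (by
      filter_upwards [eventually_le_atBot t] with s hs using hanti (hs.trans ht) ht hs)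
  nlinarith [Real.exp_pos (k * t)]

/-- For the repelling flow `D' = -k D` in backward time, a solution up to an error `e` that is not
exponentially large at `-∞` is small on the whole half line. -/
theorem abs_le_div_of_flow {D D' : ℝ → ℝ} {k e : ℝ} (hk : 0 < k)
    (hc : ContinuousOn D (Set.Iic 0)) (hD : ∀ t < 0, HasDerivAt D (D' t) t)
    (hb : ∀ t < 0, |D' t + k * D t| ≤ e)
    (hlim : Tendsto (fun t => Real.exp (k * t) * D t) atBot (𝓝 0)) {t : ℝ} (ht : t ≤ 0) :
    |D t| ≤ e / k := by
  refine abs_le.2 ⟨?_, le_div_of_flow_le hk hc hD (fun t ht => (abs_le.1 (hb t ht)).2) hlim ht⟩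
  have := le_div_of_flow_le (D := fun t => -D t) (D' := fun t => -D' t) (e := e) hk hc.neg
    (fun t ht => (hD t ht).neg)
    (fun t ht => by linarith [(abs_le.1 (hb t ht)).1]) (by simpa using hlim.neg) ht
  linarith

theorem neg_sub_le_of_flow_le {D D' : ℝ → ℝ} {k e : ℝ} (hk : k < 0) (he : 0 ≤ e)
    (hc : ContinuousOn D (Set.Iic 0)) (hD : ∀ t < 0, HasDerivAt D (D' t) t)
    (hb : ∀ t < 0, D' t + k * D t ≤ e) {t : ℝ} (ht : t ≤ 0) :
    -|D 0| - e / |k| ≤ D t := by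
  have h1 := antitoneOn_exp_mul_sub_div hk.ne hc hD hb ht (Set.mem_Iic.2 le_rfl) ht
  have h2 : e / k = -(e / |k|) := by rw [abs_of_neg hk, div_neg, neg_neg]
  have h3 : 0 ≤ e / |k| := by positivity
  simp only [h2, mul_zero, Real.exp_zero, one_mul, sub_neg_eq_add] at h1
  have h4 : 1 ≤ Real.exp (k * t) := Real.one_le_exp (mul_nonneg_of_nonpos_of_nonpos hk.le ht)
  by_contra! h
  have h5 : D t + e / |k| < -|D 0| := by linarith
  nlinarith [neg_abs_le (D 0), abs_nonneg (D 0)]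

/-- For the attracting flow in backward time, a solution up to an error `e` is controlled by its
value at `0`. -/
theorem abs_le_abs_zero_add_of_flow {D D' : ℝ → ℝ} {k e : ℝ} (hk : k < 0) (he : 0 ≤ e)
    (hc : ContinuousOn D (Set.Iic 0)) (hD : ∀ t < 0, HasDerivAt D (D' t) t)
    (hb : ∀ t < 0, |D' t + k * D t| ≤ e) {t : ℝ} (ht : t ≤ 0) :
    |D t| ≤ |D 0| + e / |k| := by
  have h1 := neg_sub_le_of_flow_le hk he hc hD (fun t ht => (abs_le.1 (hb t ht)).2) ht
  have h2 := neg_sub_le_of_flow_le (D := fun t => -D t) (D' := fun t => -D' t) (e := e) hk he hc.neg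
    (fun t ht => (hD t ht).neg)
    (fun t ht => by linarith [(abs_le.1 (hb t ht)).1]) ht
  rw [abs_neg] at h2
  exact abs_le.2 ⟨by linarith, by linarith⟩

/-! ### Averaging over a strip -/

theorem norm_sub_le_on_cross_section {W : ℂ → ℂ} {N : ℝ}
    (hc : ContinuousOn W {s | s.re ≤ 0 ∧ 0 ≤ s.im ∧ s.im ≤ 1})
    (hd : ∀ s : ℂ, s.re ≤ 0 → 0 < s.im → s.im < 1 → DifferentiableAt ℂ W s ∧ ‖deriv W s‖ ≤ N)
    {τ : ℝ} (hτ : τ ≤ 0) {σ ρ : ℝ} (hσ : 0 ≤ σ) (hσρ : σ ≤ ρ) (hρ : ρ ≤ 1) :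
    ‖W (τ + ρ * Complex.I) - W (τ + σ * Complex.I)‖ ≤ N * (ρ - σ) := by
  have hpath : Continuous fun t : ℝ => (τ : ℂ) + t * Complex.I := by fun_prop
  refine norm_sub_le_of_norm_deriv_le_Ioo (g := fun t => W (τ + t * Complex.I))
    (g' := fun t => deriv W (τ + t * Complex.I) * Complex.I) hσρ ?_ ?_ ?_
  · refine hc.comp hpath.continuousOn fun t ht => ?_
    simpa using And.intro hτ ⟨hσ.trans ht.1, ht.2.trans hρ⟩
  · intro t ht
    have h1 := (hd (τ + t * Complex.I) (by simpa using hτ) (by simpa using hσ.trans_lt ht.1)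
      (by simpa using ht.2.trans_le hρ)).1.hasDerivAt
    have h2 : HasDerivAt (fun t : ℝ => (τ : ℂ) + t * Complex.I) Complex.I t := by
      simpa using (((hasDerivAt_id t).ofReal_comp).mul_const Complex.I).const_add (τ : ℂ)
    exact h1.comp t h2
  · intro t ht
    rw [norm_mul, Complex.norm_I, mul_one]
    exact (hd (τ + t * Complex.I) (by simpa using hτ) (by simpa using hσ.trans_lt ht.1)
      (by simpa using ht.2.trans_le hρ)).2

/-- A holomorphic function on a half strip with derivative bounded by `N`, whose boundary values
lie on two lines of slopes `α₀`, `α₁`: the average `A` of its real part over the cross sections is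
uniformly close to the real part and solves, up to a small error, the equation
`A' = (α₁ - α₀) A + (β₁ - β₀)`. Indeed, by Cauchy's theorem on rectangles, the derivative of `A`
is the difference of the imaginary parts on the two boundary lines. -/
theorem exists_strip_average {W : ℂ → ℂ} {N α₀ β₀ α₁ β₁ : ℝ}
    (hc : ContinuousOn W {s | s.re ≤ 0 ∧ 0 ≤ s.im ∧ s.im ≤ 1})
    (hd : ∀ s : ℂ, s.re ≤ 0 → 0 < s.im → s.im < 1 → DifferentiableAt ℂ W s ∧ ‖deriv W s‖ ≤ N)
    (h0 : ∀ τ : ℝ, τ ≤ 0 → (W τ).im = α₀ * (W τ).re + β₀)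
    (h1 : ∀ τ : ℝ, τ ≤ 0 → (W (τ + Complex.I)).im = α₁ * (W (τ + Complex.I)).re + β₁) :
    ∃ A B : ℝ → ℝ, (∀ τ, HasDerivAt A (B τ) τ) ∧
      (∀ τ : ℝ, τ ≤ 0 → |B τ - ((α₁ - α₀) * A τ + (β₁ - β₀))| ≤ (|α₁| + |α₀|) * N) ∧
      ∀ τ : ℝ, τ ≤ 0 → ∀ σ ∈ Set.Icc (0 : ℝ) 1, |(W (τ + σ * Complex.I)).re - A τ| ≤ N := by
  have hline : ∀ σ ∈ Set.Icc (0 : ℝ) 1,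
      ContinuousOn (fun x : ℝ => W (x + σ * Complex.I)) (Set.Iic 0) := by
    intro σ hσ
    refine hc.comp (by fun_prop) fun x hx => ?_
    simpa using ⟨hx, hσ⟩
  have hcross : ∀ τ ≤ 0,
      ContinuousOn (fun y : ℝ => W ((τ : ℝ) + y * Complex.I)) (Set.Icc 0 1) := by
    intro τ hτ
    refine hc.comp (by fun_prop) fun y hy => ?_
    simpa using ⟨hτ, hy⟩
  have hcross_int : ∀ τ ≤ 0, IntervalIntegrable (fun y : ℝ => W ((τ : ℝ) + y * Complex.I))
      MeasureTheory.volume 0 1 := by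
    intro τ hτ
    refine ContinuousOn.intervalIntegrable ?_
    rw [Set.uIcc_of_le zero_le_one]
    exact hcross τ hτ
  -- `min τ 0` makes `B` continuous on the whole line, which gives two-sided derivatives at `0`.
  set B : ℝ → ℝ := fun τ =>
    (W ((min τ 0 : ℝ) + (1 : ℝ) * Complex.I)).im - (W ((min τ 0 : ℝ) + (0 : ℝ) * Complex.I)).im
    with hB
  have hmin : ∀ σ ∈ Set.Icc (0 : ℝ) 1,
      Continuous fun τ : ℝ => W ((min τ 0 : ℝ) + σ * Complex.I) := fun σ hσ =>
    (hline σ hσ).comp_continuous (continuous_id.min continuous_const)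
      fun τ => Set.mem_Iic.2 (min_le_right _ _)
  have hBc : Continuous B :=
    (Complex.continuous_im.comp (hmin 1 ⟨zero_le_one, le_rfl⟩)).sub
      (Complex.continuous_im.comp (hmin 0 ⟨le_rfl, zero_le_one⟩))
  set A : ℝ → ℝ := fun τ =>
    (∫ y in (0 : ℝ)..1, (W ((0 : ℝ) + y * Complex.I)).re) + ∫ x in (0 : ℝ)..τ, B x with hA
  have hAavg : ∀ τ ≤ 0, A τ = ∫ y in (0 : ℝ)..1, (W ((τ : ℝ) + y * Complex.I)).re := by
    intro τ hτ
    have hrect := Complex.integral_boundary_rect_eq_zero_of_continuousOn_of_differentiableOn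
      W (τ : ℂ) Complex.I
      (hc.mono (by
        intro s hs
        rw [Complex.mem_reProdIm] at hs
        simp only [Complex.ofReal_re, Complex.I_re, Complex.ofReal_im, Complex.I_im,
          Set.uIcc_of_le hτ, Set.uIcc_of_le zero_le_one, Set.mem_Icc] at hs
        exact ⟨hs.1.2, hs.2⟩))
      (by
        intro s hs
        rw [Complex.mem_reProdIm] at hs
        simp only [Complex.ofReal_re, Complex.I_re, Complex.ofReal_im, Complex.I_im,
          min_eq_left hτ, max_eq_right hτ, min_eq_left zero_le_one, max_eq_right zero_le_one,
          Set.mem_Ioo] at hs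
        exact (hd s hs.1.2.le hs.2.1 hs.2.2).1.differentiableWithinAt)
    simp only [Complex.ofReal_re, Complex.I_re, Complex.ofReal_im, Complex.I_im] at hrect
    have hseg : ∀ σ ∈ Set.Icc (0 : ℝ) 1, IntervalIntegrable
        (fun x : ℝ => W (x + σ * Complex.I)) MeasureTheory.volume τ 0 := by
      intro σ hσ
      refine ContinuousOn.intervalIntegrable ((hline σ hσ).mono ?_)
      rw [Set.uIcc_of_le hτ]
      exact Set.Icc_subset_Iic_self
    have i0 := Complex.imCLM.intervalIntegral_comp_comm (hseg 0 ⟨le_rfl, zero_le_one⟩)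
    have i1 := Complex.imCLM.intervalIntegral_comp_comm (hseg 1 ⟨zero_le_one, le_rfl⟩)
    have r0 := Complex.reCLM.intervalIntegral_comp_comm (hcross_int 0 le_rfl)
    have r1 := Complex.reCLM.intervalIntegral_comp_comm (hcross_int τ hτ)
    have him := congrArg Complex.im hrect
    simp only [Complex.imCLM_apply, Complex.reCLM_apply] at i0 i1 r0 r1
    simp only [Complex.sub_im, Complex.add_im, smul_eq_mul, Complex.I_mul_im,
      Complex.zero_im, ← i0, ← i1, ← r0, ← r1] at him
    have hBint : ∫ x in (0 : ℝ)..τ, B x = -((∫ x in τ..(0 : ℝ), (W (x + (1 : ℝ) * Complex.I)).im) -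
        ∫ x in τ..(0 : ℝ), (W (x + (0 : ℝ) * Complex.I)).im) := by
      rw [intervalIntegral.integral_symm, ← intervalIntegral.integral_sub]
      · congr 1
        refine intervalIntegral.integral_congr fun x hx => ?_
        rw [Set.uIcc_of_le hτ] at hx
        simp only [hB, min_eq_left hx.2]
      · exact ContinuousOn.intervalIntegrable (Complex.continuous_im.comp_continuousOn
          ((hline 1 ⟨zero_le_one, le_rfl⟩).mono
            (by rw [Set.uIcc_of_le hτ]; exact Set.Icc_subset_Iic_self)))
      · exact ContinuousOn.intervalIntegrable (Complex.continuous_im.comp_continuousOn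
          ((hline 0 ⟨le_rfl, zero_le_one⟩).mono
            (by rw [Set.uIcc_of_le hτ]; exact Set.Icc_subset_Iic_self)))
    simp only [hA, hBint]
    linarith
  have hclose : ∀ τ : ℝ, τ ≤ 0 → ∀ σ ∈ Set.Icc (0 : ℝ) 1, |(W (τ + σ * Complex.I)).re - A τ| ≤ N := by
    intro τ hτ σ hσ
    have hN : 0 ≤ N := (norm_nonneg _).trans
      (hd ⟨0, 1 / 2⟩ le_rfl (by norm_num) (by norm_num)).2
    have hint : IntervalIntegrable (fun y : ℝ => (W ((τ : ℝ) + y * Complex.I)).re)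
        MeasureTheory.volume 0 1 := by
      refine ContinuousOn.intervalIntegrable ?_
      rw [Set.uIcc_of_le zero_le_one]
      exact Complex.continuous_re.comp_continuousOn (hcross τ hτ)
    have heq : (W (τ + σ * Complex.I)).re - A τ = ∫ y in (0 : ℝ)..1,
        ((W (τ + σ * Complex.I)).re - (W ((τ : ℝ) + y * Complex.I)).re) := by
      rw [intervalIntegral.integral_sub intervalIntegrable_const hint, hAavg τ hτ]
      simp
    rw [heq, ← Real.norm_eq_abs]
    refine (intervalIntegral.norm_integral_le_of_norm_le_const (C := N) fun y hy => ?_).trans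
      (by simp)
    rw [Set.uIoc_of_le zero_le_one] at hy
    rw [← Complex.sub_re]
    refine (Complex.abs_re_le_norm _).trans ?_
    rcases le_total σ y with h | h
    · rw [norm_sub_rev]
      refine (norm_sub_le_on_cross_section hc hd hτ hσ.1 h hy.2).trans ?_
      nlinarith [hσ.1, hy.2]
    · refine (norm_sub_le_on_cross_section hc hd hτ hy.1.le h hσ.2).trans ?_
      nlinarith [hσ.2, hy.1]
  refine ⟨A, B, fun τ => ?_, fun τ hτ => ?_, hclose⟩
  · exact (intervalIntegral.integral_hasDerivAt_right (hBc.intervalIntegrable _ _)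
      hBc.aestronglyMeasurable.stronglyMeasurableAtFilter hBc.continuousAt).const_add _
  · have e0 := hclose τ hτ 0 ⟨le_rfl, zero_le_one⟩
    have e1 := hclose τ hτ 1 ⟨zero_le_one, le_rfl⟩
    have b0 := h0 τ hτ
    have b1 := h1 τ hτ
    simp only [hB, min_eq_left hτ]
    simp only [Complex.ofReal_zero, zero_mul, add_zero, Complex.ofReal_one, one_mul] at e0 e1 ⊢
    rw [b0, b1]
    calc |α₁ * (W (τ + Complex.I)).re + β₁ - (α₀ * (W τ).re + β₀)
          - ((α₁ - α₀) * A τ + (β₁ - β₀))|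
        = |α₁ * ((W (τ + Complex.I)).re - A τ) - α₀ * ((W τ).re - A τ)| := by ring_nf
      _ ≤ |α₁ * ((W (τ + Complex.I)).re - A τ)| + |α₀ * ((W τ).re - A τ)| := abs_sub _ _
      _ ≤ |α₁| * N + |α₀| * N := by
        rw [abs_mul, abs_mul]
        gcongr
      _ = _ := by ring

/-! ### Holomorphic disks with boundary on three nearly horizontal lines -/

/-- The boundary arcs of the half plane between consecutive marked points, in the order in which
they are mapped to the lines `L 0`, `L 1`, `L 2`. -/
def boundaryArc : Fin 3 → Set ℝ := ![Set.Ioo 0 1, Set.Ioi 1, Set.Iio 0]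

/-- A holomorphic map of the half plane of height `O(ε)`, with boundary arcs mapped to the lines
`y = ε (a i x + b i)`. This is all that is used about the Schwarz–Christoffel maps; conformality
plays no further role. -/
structure IsThinDisk (a b : Fin 3 → ℝ) (M ε : ℝ) (w : ℂ → ℂ) : Prop where
  continuousOn : ContinuousOn w closedHalfPlane
  holomorphic : DifferentiableOn ℂ w openHalfPlane
  abs_re_le : ∀ z ∈ closedHalfPlane, |(w z).re| ≤ M
  abs_im_le : ∀ z ∈ closedHalfPlane, |(w z).im| ≤ ε * M
  boundary : ∀ i, ∀ t ∈ boundaryArc i, (w t).im = ε * (a i * (w t).re + b i)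

/-- A real interval that avoids the marked points `0` and `1` lies in a single boundary arc. -/
theorem exists_forall_mem_boundaryArc {x r : ℝ} (h0 : r ≤ |x|) (h1 : r ≤ |x - 1|) (hr : 0 < r) :
    ∃ i, ∀ t : ℝ, |t - x| < r → t ∈ boundaryArc i := by
  rcases lt_trichotomy x 0 with h | h | h
  · refine ⟨2, fun t ht => ?_⟩
    rw [abs_of_neg h] at h0
    show t < 0
    linarith [(abs_lt.1 ht).2]
  · rw [h, abs_zero] at h0
    linarith
  · rw [abs_of_pos h] at h0
    rcases lt_trichotomy x 1 with h' | h' | h'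
    · refine ⟨0, fun t ht => ?_⟩
      rw [abs_of_neg (by linarith)] at h1
      rw [abs_lt] at ht
      exact ⟨by linarith, by linarith⟩
    · rw [h', sub_self, abs_zero] at h1
      linarith
    · refine ⟨1, fun t ht => ?_⟩
      rw [abs_of_pos (by linarith)] at h1
      show 1 < t
      linarith [(abs_lt.1 ht).1]

/-- The derivative of a thin disk is `O(ε)`, uniformly up to the boundary away from the marked
points. -/
theorem exists_norm_deriv_le (a b : Fin 3 → ℝ) (M : ℝ) :
    ∃ K > 0, ∀ ε > 0, ∀ w, IsThinDisk a b M ε w → ∀ z ∈ openHalfPlane, ∀ d > 0,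
      d ≤ ‖z‖ → d ≤ ‖z - 1‖ → ‖deriv w z‖ ≤ K * ε / d := by
  set S : ℝ := 1 + |M| + ∑ i, (|a i| * |M| + |b i|) with hS
  have hS0 : 0 < S := by positivity
  refine ⟨48 * Real.exp 2 * S, by positivity, ?_⟩
  intro ε hε w hw z hz d hd hd0 hd1
  -- Multiplying by `1 - i ε a` and subtracting a constant makes the line horizontal.
  set ζ : Fin 3 → ℂ → ℂ := fun i u =>
    (1 - Complex.I * (ε * a i : ℝ)) * w u - Complex.I * (ε * b i : ℝ) with hζ
  have him : ∀ i u, (ζ i u).im = (w u).im - ε * (a i * (w u).re + b i) := by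
    intro i u
    simp [hζ]
    ring
  have hζc : ∀ i, ContinuousOn (ζ i) closedHalfPlane := fun i =>
    (continuousOn_const.mul hw.continuousOn).sub continuousOn_const
  have hζd : ∀ i, DifferentiableOn ℂ (ζ i) openHalfPlane := fun i =>
    (hw.holomorphic.const_mul _).sub_const _
  have hζb : ∀ i, ∀ u ∈ closedHalfPlane, |(ζ i u).im| ≤ ε * S := by
    intro i u hu
    have h1 := hw.abs_im_le u hu
    have h2 := hw.abs_re_le u hu
    have h3 : |a i| * |M| + |b i| ≤ ∑ i, (|a i| * |M| + |b i|) :=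
      Finset.single_le_sum (f := fun i => |a i| * |M| + |b i|) (fun j _ => by positivity)
        (Finset.mem_univ i)
    have h4 : |a i * (w u).re + b i| ≤ |a i| * |M| + |b i| := by
      refine (abs_add_le _ _).trans ?_
      rw [abs_mul]
      linarith [mul_le_mul_of_nonneg_left (h2.trans (le_abs_self M)) (abs_nonneg (a i))]
    rw [him]
    refine (abs_sub _ _).trans ?_
    rw [abs_mul, abs_of_pos hε]
    calc |(w u).im| + ε * |a i * (w u).re + b i|
        ≤ ε * |M| + ε * (|a i| * |M| + |b i|) := by
          gcongr
          exact h1.trans (by gcongr; exact le_abs_self M)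
      _ ≤ ε * S := by rw [← mul_add]; gcongr; linarith
  have hder : ∀ i, ‖deriv w z‖ ≤ ‖deriv (ζ i) z‖ := by
    intro i
    have hwz : DifferentiableAt ℂ w z := hw.holomorphic.differentiableAt
      ((isOpen_lt continuous_const Complex.continuous_im).mem_nhds hz)
    have h1 : deriv (ζ i) z = (1 - Complex.I * (ε * a i : ℝ)) * deriv w z :=
      ((hwz.hasDerivAt.const_mul _).sub_const _).deriv
    have h2 : 1 ≤ ‖(1 : ℂ) - Complex.I * (ε * a i : ℝ)‖ := by
      refine le_trans ?_ (Complex.abs_re_le_norm _)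
      simp
    rw [h1, norm_mul]
    exact le_mul_of_one_le_left (norm_nonneg _) h2
  have hεS : 0 < ε * S := by positivity
  have hz' : 0 < z.im := hz
  rcases le_or_gt (d / 2) z.im with h | h
  · have hsub : Metric.ball z (d / 2) ⊆ openHalfPlane := by
      intro u hu
      rw [Metric.mem_ball, dist_eq_norm] at hu
      have := (abs_lt.1 ((Complex.abs_im_le_norm (u - z)).trans_lt hu)).1
      rw [Complex.sub_im] at this
      show 0 < u.im
      linarith
    refine (hder 0).trans ((norm_deriv_le_of_abs_im_le (R := d / 2) (by positivity) hεS
      ((hζd 0).mono hsub)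
      fun u hu => hζb 0 u (openHalfPlane_subset_closedHalfPlane (hsub hu))).trans ?_)
    rw [div_le_div_iff₀ (by positivity) hd]
    nlinarith [mul_pos (mul_pos (Real.exp_pos 2) hεS) hd]
  · have hx : ∀ c : ℝ, d ≤ ‖z - c‖ → d / 2 ≤ |z.re - c| := by
      intro c hc
      have h1 := Complex.norm_le_abs_re_add_abs_im (z - c)
      rw [Complex.sub_re, Complex.sub_im, Complex.ofReal_re, Complex.ofReal_im, sub_zero,
        abs_of_pos hz'] at h1
      linarith
    obtain ⟨i, hi⟩ := exists_forall_mem_boundaryArc (x := z.re) (r := d / 2)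
      (by simpa using hx 0 (by simpa using hd0)) (hx 1 (by simpa using hd1)) (by positivity)
    refine (hder i).trans ((norm_deriv_le_of_im_eq_zero_on_interval (d := d / 2) hεS (by positivity)
      (hζc i) (hζd i) (hζb i) hz fun t ht => ?_).trans ?_)
    · rw [him, hw.boundary i t (hi t ht), sub_self]
    · apply le_of_eq
      field_simp
      ring

/-- A compact part of the closed half plane, which contains `thickPart δ` and the ends of the
strip charts. -/
def compactPart (δ : ℝ) : Set ℂ :=
  {z | z ∈ closedHalfPlane ∧ δ ≤ ‖z‖ ∧ δ ≤ ‖z - 1‖ ∧ ‖z‖ ≤ δ⁻¹}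

theorem thickPart_subset_compactPart (δ : ℝ) : thickPart δ ⊆ compactPart δ := by
  rintro z ⟨hz, hz'⟩
  have hz0 : 0 ≤ z.im := hz
  simp only [Set.mem_iUnion, not_exists] at hz'
  have h0 : ¬ (0 ≤ z.im ∧ ‖z - ((1 : ℝ) : ℂ)‖ < δ) := hz' 0
  have h1 : ¬ (0 ≤ z.im ∧ δ⁻¹ < ‖z‖) := hz' 1
  have h2 : ¬ (0 ≤ z.im ∧ ‖z - ((0 : ℝ) : ℂ)‖ < δ) := hz' 2
  simp only [hz0, true_and, not_lt, Complex.ofReal_one, Complex.ofReal_zero, sub_zero] at h0 h1 h2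
  exact ⟨hz, h2, h0, h1⟩

/-- The half disks at `0` and `1` both contain `1 / 2` if `δ > 1 / 2`. -/
theorem le_half_of_disjoint_halfDisk {δ : ℝ}
    (h : ∀ i j, i ≠ j → Disjoint (halfDisk (markedPoint i) δ) (halfDisk (markedPoint j) δ)) :
    δ ≤ 1 / 2 := by
  by_contra! hδ
  have h1 : (1 / 2 : ℂ) ∈ halfDisk (markedPoint 0) δ := by
    show 0 ≤ (1 / 2 : ℂ).im ∧ ‖(1 / 2 : ℂ) - ((1 : ℝ) : ℂ)‖ < δ
    norm_num
    linarith
  have h2 : (1 / 2 : ℂ) ∈ halfDisk (markedPoint 2) δ := by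
    show 0 ≤ (1 / 2 : ℂ).im ∧ ‖(1 / 2 : ℂ) - ((0 : ℝ) : ℂ)‖ < δ
    norm_num
    linarith
  exact Set.disjoint_left.1 (h 0 2 (by decide)) h1 h2

/-- A thin disk is constant up to `O(ε)` on the compact part: every point is connected to a base
point by a vertical segment going up, which does not approach the marked points, followed by a
horizontal one. -/
theorem norm_sub_le_on_compactPart {w : ℂ → ℂ} {C δ : ℝ} (hC : 0 ≤ C) (hδ : 0 < δ)
    (hδ' : δ ≤ 1 / 2)
    (hc : ContinuousOn w closedHalfPlane) (hd : DifferentiableOn ℂ w openHalfPlane)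
    (hw : ∀ z ∈ openHalfPlane, ∀ d > 0, d ≤ ‖z‖ → d ≤ ‖z - 1‖ → ‖deriv w z‖ ≤ C / d)
    {z : ℂ} (hz : z ∈ compactPart δ) :
    ‖w z - w (δ⁻¹ * Complex.I)‖ ≤ C / δ * (2 * δ⁻¹) := by
  obtain ⟨hz0, hz1, hz2, hz3⟩ := hz
  have hop : IsOpen openHalfPlane := isOpen_lt continuous_const Complex.continuous_im
  have hzim : 0 ≤ z.im := hz0
  have hY : δ ≤ δ⁻¹ := by
    have : (1 / 2 : ℝ)⁻¹ ≤ δ⁻¹ := inv_anti₀ hδ hδ'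
    norm_num at this
    linarith
  have hY0 : 0 < δ⁻¹ := by positivity
  have hyY : z.im ≤ δ⁻¹ := (le_abs_self _).trans ((Complex.abs_im_le_norm z).trans hz3)
  have hxY : |z.re| ≤ δ⁻¹ := (Complex.abs_re_le_norm z).trans hz3
  have hCδ : 0 ≤ C / δ := by positivity
  have hvert : ‖w (z.re + (δ⁻¹ : ℝ) * Complex.I) - w (z.re + z.im * Complex.I)‖
      ≤ C / δ * (δ⁻¹ - z.im) := by
    have hmem : ∀ t : ℝ, z.im < t → (z.re + t * Complex.I : ℂ) ∈ openHalfPlane := by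
      intro t ht
      show 0 < (z.re + t * Complex.I : ℂ).im
      simpa using hzim.trans_lt ht
    have hfar : ∀ t : ℝ, z.im < t → ∀ c : ℝ, ‖z - c‖ ≤ ‖(z.re + t * Complex.I : ℂ) - c‖ := by
      intro t ht c
      rw [← sq_le_sq₀ (norm_nonneg _) (norm_nonneg _), ← Complex.normSq_eq_norm_sq,
        ← Complex.normSq_eq_norm_sq, Complex.normSq_apply, Complex.normSq_apply]
      simp
      nlinarith
    refine norm_sub_le_of_norm_deriv_le_Ioo (g := fun t => w (z.re + t * Complex.I))
      (g' := fun t => deriv w (z.re + t * Complex.I) * Complex.I) hyY ?_ ?_ ?_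
    · refine hc.comp (by fun_prop) fun t ht => ?_
      show 0 ≤ (z.re + t * Complex.I : ℂ).im
      simpa using hzim.trans ht.1
    · intro t ht
      have h2 : HasDerivAt (fun t : ℝ => (z.re : ℂ) + t * Complex.I) Complex.I t := by
        simpa using (((hasDerivAt_id t).ofReal_comp).mul_const Complex.I).const_add (z.re : ℂ)
      exact (hd.differentiableAt (hop.mem_nhds (hmem t ht.1))).hasDerivAt.comp t h2
    · intro t ht
      rw [norm_mul, Complex.norm_I, mul_one]
      refine hw _ (hmem t ht.1) δ hδ (hz1.trans ?_) (hz2.trans ?_)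
      · simpa using hfar t ht.1 0
      · simpa using hfar t ht.1 1
  have hhor : ‖w (z.re + (δ⁻¹ : ℝ) * Complex.I) - w ((δ⁻¹ : ℝ) * Complex.I)‖
      ≤ C / δ * ‖(z.re + (δ⁻¹ : ℝ) * Complex.I) - ((δ⁻¹ : ℝ) * Complex.I : ℂ)‖ := by
    have hpos : ∀ u ∈ {u : ℂ | δ⁻¹ ≤ u.im}, u ∈ openHalfPlane := fun u hu =>
      hY0.trans_le (show δ⁻¹ ≤ u.im from hu)
    refine Convex.norm_image_sub_le_of_norm_deriv_le (s := {u : ℂ | δ⁻¹ ≤ u.im})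
      (fun u hu => hd.differentiableAt (hop.mem_nhds (hpos u hu))) (fun u hu => ?_)
      (convex_halfSpace_im_ge _) (by simp) (by simp)
    have hu' : δ⁻¹ ≤ u.im := hu
    refine hw u (hpos u hu) δ hδ ?_ ?_
    · exact hY.trans (hu'.trans ((le_abs_self _).trans (Complex.abs_im_le_norm u)))
    · have := Complex.abs_im_le_norm (u - 1)
      rw [Complex.sub_im, Complex.one_im, sub_zero] at this
      exact hY.trans (hu'.trans ((le_abs_self _).trans this))
  rw [add_sub_cancel_right, Complex.norm_real, Real.norm_eq_abs] at hhor
  rw [Complex.re_add_im] at hvert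
  calc ‖w z - w (δ⁻¹ * Complex.I)‖
      ≤ ‖w z - w (z.re + (δ⁻¹ : ℝ) * Complex.I)‖
        + ‖w (z.re + (δ⁻¹ : ℝ) * Complex.I) - w (δ⁻¹ * Complex.I)‖ :=
        norm_sub_le_norm_sub_add_norm_sub _ _ _
    _ ≤ C / δ * (δ⁻¹ - z.im) + C / δ * |z.re| := by
        rw [norm_sub_rev (w z)]
        gcongr
    _ ≤ C / δ * δ⁻¹ + C / δ * δ⁻¹ := by gcongr; linarith
    _ = _ := by ring

/-! ### The strip charts at the marked points -/

theorem stripChart_coe (p δ : ℝ) (s : ℂ) :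
    stripChart (p : OnePoint ℝ) δ (s.re, s.im) = p + δ * Complex.exp (Real.pi * s) := by
  show (p : ℂ) + (δ : ℂ) * Complex.exp (Real.pi * (s.re + Complex.I * s.im)) = _
  rw [mul_comm Complex.I, Complex.re_add_im]

theorem stripChart_infty (δ : ℝ) (s : ℂ) :
    stripChart ∞ δ (s.re, s.im) = -(δ : ℂ)⁻¹ * Complex.exp (-Real.pi * s) := by
  show -(δ : ℂ)⁻¹ * Complex.exp (-Real.pi * (s.re + Complex.I * s.im)) = _
  rw [mul_comm Complex.I, Complex.re_add_im]

/-- The properties of a strip chart `Φ` at the `i`-th marked point, with respect to the complex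
coordinate `s = τ + i σ`. In `norm_deriv_le`, `d` bounds the distance to the marked points from
below, and the estimate says that `Φ` compensates for the growth of derivatives there. -/
structure IsEndChart (i : Fin 3) (δ : ℝ) (Φ : ℂ → ℂ) : Prop where
  differentiable : Differentiable ℂ Φ
  mem_closed : ∀ s, 0 ≤ s.im → s.im ≤ 1 → Φ s ∈ closedHalfPlane
  mem_open : ∀ s, 0 < s.im → s.im < 1 → Φ s ∈ openHalfPlane
  norm_deriv_le : ∀ s, s.re ≤ 0 → ∃ d > 0, d ≤ ‖Φ s‖ ∧ d ≤ ‖Φ s - 1‖ ∧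
    ‖deriv Φ s‖ ≤ 2 * Real.pi * d
  lower : ∀ τ : ℝ, τ ≤ 0 → ∃ t ∈ boundaryArc (i + 1), Φ τ = (t : ℝ)
  upper : ∀ τ : ℝ, τ ≤ 0 → ∃ t ∈ boundaryArc i, Φ (τ + Complex.I) = (t : ℝ)
  zero_mem : Φ 0 ∈ compactPart δ

theorem im_exp_pi_nonneg {s : ℂ} (h0 : 0 ≤ s.im) (h1 : s.im ≤ 1) :
    0 ≤ (Complex.exp (Real.pi * s)).im := by
  rw [Complex.exp_im, Complex.im_ofReal_mul]
  exact mul_nonneg (Real.exp_pos _).le (Real.sin_nonneg_of_nonneg_of_le_pi (by positivity)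
    (by nlinarith [Real.pi_pos]))

theorem im_exp_pi_pos {s : ℂ} (h0 : 0 < s.im) (h1 : s.im < 1) :
    0 < (Complex.exp (Real.pi * s)).im := by
  rw [Complex.exp_im, Complex.im_ofReal_mul]
  exact mul_pos (Real.exp_pos _) (Real.sin_pos_of_pos_of_lt_pi (by positivity)
    (by nlinarith [Real.pi_pos]))

theorem norm_exp_pi (s : ℂ) : ‖Complex.exp (Real.pi * s)‖ = Real.exp (Real.pi * s.re) := by
  rw [Complex.norm_exp, Complex.re_ofReal_mul]

theorem exp_pi_add_I (τ : ℝ) :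
    Complex.exp (Real.pi * (τ + Complex.I)) = -(Real.exp (Real.pi * τ) : ℝ) := by
  rw [mul_add, Complex.exp_add, Complex.exp_pi_mul_I]
  push_cast
  ring

theorem exp_neg_pi (s : ℂ) : Complex.exp (-Real.pi * s) = (Complex.exp (Real.pi * s))⁻¹ := by
  rw [neg_mul, Complex.exp_neg]

theorem hasDerivAt_exp_pi (c : ℂ) (s : ℂ) :
    HasDerivAt (fun s => Complex.exp (c * s)) (c * Complex.exp (c * s)) s := by
  simpa [mul_comm] using ((hasDerivAt_id s).const_mul c).cexp

theorem isEndChart_one {δ : ℝ} (hδ : 0 < δ) (hδ' : δ ≤ 1 / 2) :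
    IsEndChart 0 δ fun s => (1 : ℝ) + δ * Complex.exp (Real.pi * s) := by
  have hr : ∀ s : ℂ, s.re ≤ 0 → δ * Real.exp (Real.pi * s.re) ≤ δ := fun s hs =>
    mul_le_of_le_one_right hδ.le (Real.exp_le_one_iff.2
      (mul_nonpos_of_nonneg_of_nonpos Real.pi_pos.le hs))
  have hn : ∀ s : ℂ, ‖(δ : ℂ) * Complex.exp (Real.pi * s)‖ = δ * Real.exp (Real.pi * s.re) :=
    fun s => by rw [norm_mul, norm_exp_pi, Complex.norm_real, Real.norm_of_nonneg hδ.le]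
  have hlow : ∀ s : ℂ,
      1 - δ * Real.exp (Real.pi * s.re) ≤ ‖(1 : ℝ) + δ * Complex.exp (Real.pi * s)‖ := by
    intro s
    rw [← hn]
    simpa using norm_sub_norm_le (1 : ℂ) (-(δ * Complex.exp (Real.pi * s)))
  have hone : ∀ s : ℂ, ‖(1 : ℝ) + δ * Complex.exp (Real.pi * s) - 1‖ =
      δ * Real.exp (Real.pi * s.re) := by
    intro s
    rw [← hn]
    simp
  have him : ∀ s : ℂ, ((1 : ℝ) + δ * Complex.exp (Real.pi * s)).im =
      δ * (Complex.exp (Real.pi * s)).im := fun s => by simp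
  refine ⟨by fun_prop, fun s h0 h1 => ?_, fun s h0 h1 => ?_, fun s hs => ?_, fun τ hτ => ?_,
    fun τ hτ => ?_, ?_⟩
  · show 0 ≤ ((1 : ℝ) + δ * Complex.exp (Real.pi * s)).im
    rw [him]
    exact mul_nonneg hδ.le (im_exp_pi_nonneg h0 h1)
  · show 0 < ((1 : ℝ) + δ * Complex.exp (Real.pi * s)).im
    rw [him]
    exact mul_pos hδ (im_exp_pi_pos h0 h1)
  · refine ⟨δ * Real.exp (Real.pi * s.re), by positivity, ?_, ?_, ?_⟩
    · linarith [hr s hs, hlow s]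
    · exact (hone s).ge
    · rw [(((hasDerivAt_exp_pi Real.pi s).const_mul (δ : ℂ)).const_add _).deriv, mul_left_comm,
        norm_mul, hn, Complex.norm_real, Real.norm_of_nonneg Real.pi_pos.le]
      have : 0 < Real.pi * (δ * Real.exp (Real.pi * s.re)) := by positivity
      linarith
  · refine ⟨1 + δ * Real.exp (Real.pi * τ), ?_, by push_cast; rfl⟩
    show 1 < 1 + δ * Real.exp (Real.pi * τ)
    have : 0 < δ * Real.exp (Real.pi * τ) := by positivity
    linarith
  · refine ⟨1 - δ * Real.exp (Real.pi * τ), ?_, by rw [exp_pi_add_I]; push_cast; ring⟩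
    have h1 : 0 < δ * Real.exp (Real.pi * τ) := by positivity
    have h2 := hr τ hτ
    rw [Complex.ofReal_re] at h2
    exact ⟨by linarith, by linarith⟩
  · have h2 : (2 : ℝ) ≤ δ⁻¹ := by
      rw [le_inv_comm₀ two_pos hδ]
      linarith
    simp only [mul_zero, Complex.exp_zero, mul_one]
    rw [← Complex.ofReal_add]
    have h3 : ((1 + δ : ℝ) : ℂ) - 1 = δ := by push_cast; ring
    refine ⟨by simp [closedHalfPlane], ?_, ?_, ?_⟩
    · rw [Complex.norm_real, Real.norm_of_nonneg (by linarith)]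
      linarith
    · rw [h3, Complex.norm_real, Real.norm_of_nonneg hδ.le]
    · rw [Complex.norm_real, Real.norm_of_nonneg (by linarith)]
      linarith

theorem isEndChart_zero {δ : ℝ} (hδ : 0 < δ) (hδ' : δ ≤ 1 / 2) :
    IsEndChart 2 δ fun s => (0 : ℝ) + δ * Complex.exp (Real.pi * s) := by
  simp only [Complex.ofReal_zero, zero_add]
  have hr : ∀ s : ℂ, s.re ≤ 0 → δ * Real.exp (Real.pi * s.re) ≤ δ := fun s hs =>
    mul_le_of_le_one_right hδ.le (Real.exp_le_one_iff.2
      (mul_nonpos_of_nonneg_of_nonpos Real.pi_pos.le hs))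
  have hn : ∀ s : ℂ, ‖(δ : ℂ) * Complex.exp (Real.pi * s)‖ = δ * Real.exp (Real.pi * s.re) :=
    fun s => by rw [norm_mul, norm_exp_pi, Complex.norm_real, Real.norm_of_nonneg hδ.le]
  have hlow : ∀ s : ℂ,
      1 - δ * Real.exp (Real.pi * s.re) ≤ ‖(δ : ℂ) * Complex.exp (Real.pi * s) - 1‖ := by
    intro s
    rw [← hn, norm_sub_rev]
    simpa using norm_sub_norm_le (1 : ℂ) (δ * Complex.exp (Real.pi * s))
  refine ⟨by fun_prop, fun s h0 h1 => ?_, fun s h0 h1 => ?_, fun s hs => ?_, fun τ hτ => ?_,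
    fun τ hτ => ?_, ?_⟩
  · show 0 ≤ ((δ : ℂ) * Complex.exp (Real.pi * s)).im
    rw [Complex.im_ofReal_mul]
    exact mul_nonneg hδ.le (im_exp_pi_nonneg h0 h1)
  · show 0 < ((δ : ℂ) * Complex.exp (Real.pi * s)).im
    rw [Complex.im_ofReal_mul]
    exact mul_pos hδ (im_exp_pi_pos h0 h1)
  · refine ⟨δ * Real.exp (Real.pi * s.re), by positivity, (hn s).ge, ?_, ?_⟩
    · linarith [hr s hs, hlow s]
    · rw [((hasDerivAt_exp_pi Real.pi s).const_mul (δ : ℂ)).deriv, mul_left_comm,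
        norm_mul, hn, Complex.norm_real, Real.norm_of_nonneg Real.pi_pos.le]
      have : 0 < Real.pi * (δ * Real.exp (Real.pi * s.re)) := by positivity
      linarith
  · refine ⟨δ * Real.exp (Real.pi * τ), ?_, by push_cast; rfl⟩
    have h1 : 0 < δ * Real.exp (Real.pi * τ) := by positivity
    have h2 := hr τ hτ
    rw [Complex.ofReal_re] at h2
    show δ * Real.exp (Real.pi * τ) ∈ Set.Ioo (0 : ℝ) 1
    exact ⟨by linarith, by linarith⟩
  · refine ⟨-(δ * Real.exp (Real.pi * τ)), ?_, by rw [exp_pi_add_I]; push_cast; ring⟩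
    show -(δ * Real.exp (Real.pi * τ)) < 0
    have : 0 < δ * Real.exp (Real.pi * τ) := by positivity
    linarith
  · have h2 : (2 : ℝ) ≤ δ⁻¹ := by
      rw [le_inv_comm₀ two_pos hδ]
      linarith
    have h3 := hlow 0
    simp only [Complex.zero_re, mul_zero, Real.exp_zero, mul_one, Complex.exp_zero] at h3 ⊢
    refine ⟨by simp [closedHalfPlane], ?_, by linarith, ?_⟩
    · rw [Complex.norm_real, Real.norm_of_nonneg hδ.le]
    · rw [Complex.norm_real, Real.norm_of_nonneg hδ.le]
      linarith

theorem isEndChart_infty {δ : ℝ} (hδ : 0 < δ) (hδ' : δ ≤ 1 / 2) :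
    IsEndChart 1 δ fun s => -(δ : ℂ)⁻¹ * Complex.exp (-Real.pi * s) := by
  have hY : (2 : ℝ) ≤ δ⁻¹ := by
    rw [le_inv_comm₀ two_pos hδ]
    linarith
  have hr : ∀ s : ℂ, s.re ≤ 0 → δ⁻¹ ≤ δ⁻¹ * Real.exp (-Real.pi * s.re) := fun s hs =>
    le_mul_of_one_le_right (by linarith) (Real.one_le_exp
      (by nlinarith [Real.pi_pos]))
  have hn : ∀ s : ℂ, ‖-(δ : ℂ)⁻¹ * Complex.exp (-Real.pi * s)‖ =
      δ⁻¹ * Real.exp (-Real.pi * s.re) := fun s => by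
    rw [norm_mul, norm_neg, norm_inv, Complex.norm_real, Real.norm_of_nonneg hδ.le,
      Complex.norm_exp, ← Complex.ofReal_neg, Complex.re_ofReal_mul]
  have hlow : ∀ s : ℂ, δ⁻¹ * Real.exp (-Real.pi * s.re) - 1 ≤
      ‖-(δ : ℂ)⁻¹ * Complex.exp (-Real.pi * s) - 1‖ := by
    intro s
    rw [← hn]
    simpa using norm_sub_norm_le (-(δ : ℂ)⁻¹ * Complex.exp (-Real.pi * s)) 1
  have him : ∀ s : ℂ, (-(δ : ℂ)⁻¹ * Complex.exp (-Real.pi * s)).im =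
      δ⁻¹ * ((Complex.exp (Real.pi * s)).im / Complex.normSq (Complex.exp (Real.pi * s))) := by
    intro s
    rw [exp_neg_pi, ← Complex.ofReal_inv, ← Complex.ofReal_neg, Complex.im_ofReal_mul,
      Complex.inv_im]
    ring
  refine ⟨by fun_prop, fun s h0 h1 => ?_, fun s h0 h1 => ?_, fun s hs => ?_, fun τ hτ => ?_,
    fun τ hτ => ?_, ?_⟩
  · show 0 ≤ (-(δ : ℂ)⁻¹ * Complex.exp (-Real.pi * s)).im
    rw [him]
    exact mul_nonneg (by linarith) (div_nonneg (im_exp_pi_nonneg h0 h1) (Complex.normSq_nonneg _))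
  · show 0 < (-(δ : ℂ)⁻¹ * Complex.exp (-Real.pi * s)).im
    rw [him]
    exact mul_pos (by linarith) (div_pos (im_exp_pi_pos h0 h1)
      (Complex.normSq_pos.2 (Complex.exp_ne_zero _)))
  · refine ⟨δ⁻¹ * Real.exp (-Real.pi * s.re) / 2, by positivity, ?_, ?_, ?_⟩
    · rw [hn]
      linarith [hr s hs]
    · linarith [hr s hs, hlow s]
    · rw [((hasDerivAt_exp_pi (-Real.pi) s).const_mul (-(δ : ℂ)⁻¹)).deriv, mul_left_comm,
        norm_mul, hn, norm_neg, Complex.norm_real, Real.norm_of_nonneg Real.pi_pos.le]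
      apply le_of_eq
      ring
  · refine ⟨-(δ⁻¹ * Real.exp (-Real.pi * τ)), ?_, by push_cast; ring⟩
    show -(δ⁻¹ * Real.exp (-Real.pi * τ)) < 0
    have : 0 < δ⁻¹ * Real.exp (-Real.pi * τ) := by positivity
    linarith
  · refine ⟨δ⁻¹ * Real.exp (-Real.pi * τ), ?_, ?_⟩
    · show 1 < δ⁻¹ * Real.exp (-Real.pi * τ)
      have := hr τ hτ
      rw [Complex.ofReal_re] at this
      linarith
    · rw [exp_neg_pi, exp_pi_add_I, neg_mul Real.pi τ, Real.exp_neg]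
      push_cast
      rw [inv_neg]
      ring
  · have h3 := hlow 0
    have h4 := hn 0
    simp only [Complex.zero_re, mul_zero, Real.exp_zero, mul_one, Complex.exp_zero] at h3 h4 ⊢
    refine ⟨?_, by linarith, by linarith, h4.le⟩
    show 0 ≤ (-(δ : ℂ)⁻¹).im
    rw [← Complex.ofReal_inv, ← Complex.ofReal_neg, Complex.ofReal_im]

theorem isEndChart_stripChart (i : Fin 3) {δ : ℝ} (hδ : 0 < δ) (hδ' : δ ≤ 1 / 2) :
    IsEndChart i δ fun s => stripChart (markedPoint i) δ (s.re, s.im) := by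
  fin_cases i
  · have h := isEndChart_one hδ hδ'
    rw [← funext (stripChart_coe 1 δ)] at h
    exact h
  · have h := isEndChart_infty hδ hδ'
    rw [← funext (stripChart_infty δ)] at h
    exact h
  · have h := isEndChart_zero hδ hδ'
    rw [← funext (stripChart_coe 0 δ)] at h
    exact h

/-! ### Thin disks follow the gradient flow -/

/-- In a strip chart at a marked point, the averages of `Re w` over the cross sections solve the
gradient flow equation, slowed down by the factor `ε`, up to an error `O(ε²)`. -/
theorem exists_end_average (a b : Fin 3 → ℝ) (M : ℝ) :
    ∃ N > 0, ∀ ε > 0, ∀ w, IsThinDisk a b M ε w → ∀ i δ Φ, IsEndChart i δ Φ →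
      ∃ A B : ℝ → ℝ, (∀ τ, HasDerivAt A (B τ) τ) ∧
        (∀ τ ≤ 0, |B τ + ε * ((a (i + 1) - a i) * A τ + (b (i + 1) - b i))| ≤ N * ε ^ 2) ∧
        ∀ τ : ℝ, τ ≤ 0 → ∀ σ ∈ Set.Icc (0 : ℝ) 1,
          |(w (Φ (τ + σ * Complex.I))).re - A τ| ≤ N * ε := by
  obtain ⟨K, hK, hgrad⟩ := exists_norm_deriv_le a b M
  have hpi := Real.pi_pos
  set T : ℝ := ∑ j, |a j| with hT
  have hT0 : 0 ≤ T := by positivity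
  have haT : ∀ j, |a j| ≤ T := fun j =>
    Finset.single_le_sum (f := fun j => |a j|) (fun k _ => abs_nonneg _) (Finset.mem_univ j)
  refine ⟨2 * Real.pi * K * (1 + 2 * T), by positivity, ?_⟩
  intro ε hε w hw i δ Φ hΦ
  have hcont : ContinuousOn (fun s => w (Φ s)) {s : ℂ | s.re ≤ 0 ∧ 0 ≤ s.im ∧ s.im ≤ 1} :=
    hw.continuousOn.comp hΦ.differentiable.continuous.continuousOn
      fun s hs => hΦ.mem_closed s hs.2.1 hs.2.2
  have hder : ∀ s : ℂ, s.re ≤ 0 → 0 < s.im → s.im < 1 →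
      DifferentiableAt ℂ (fun s => w (Φ s)) s ∧
        ‖deriv (fun s => w (Φ s)) s‖ ≤ 2 * Real.pi * K * ε := by
    intro s hs h0 h1
    have hmem := hΦ.mem_open s h0 h1
    have hd1 : DifferentiableAt ℂ w (Φ s) := hw.holomorphic.differentiableAt
      ((isOpen_lt continuous_const Complex.continuous_im).mem_nhds hmem)
    have hd2 : DifferentiableAt ℂ Φ s := hΦ.differentiable s
    have hcomp := hd1.hasDerivAt.comp s hd2.hasDerivAt
    refine ⟨hcomp.differentiableAt, ?_⟩
    obtain ⟨d, hd, hd0, hdone, hdΦ⟩ := hΦ.norm_deriv_le s hs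
    have h2 : deriv (fun s => w (Φ s)) s = deriv w (Φ s) * deriv Φ s := hcomp.deriv
    rw [h2, norm_mul]
    calc ‖deriv w (Φ s)‖ * ‖deriv Φ s‖ ≤ K * ε / d * (2 * Real.pi * d) := by
          gcongr
          exact hgrad ε hε w hw _ hmem d hd hd0 hdone
      _ = _ := by field_simp
  obtain ⟨A, B, hAB, hB, hA⟩ := exists_strip_average (α₀ := ε * a (i + 1)) (β₀ := ε * b (i + 1))
    (α₁ := ε * a i) (β₁ := ε * b i) hcont hder
    (fun τ hτ => by
      obtain ⟨t, ht, h⟩ := hΦ.lower τ hτ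
      rw [h, hw.boundary _ t ht]
      ring)
    (fun τ hτ => by
      obtain ⟨t, ht, h⟩ := hΦ.upper τ hτ
      rw [h, hw.boundary _ t ht]
      ring)
  refine ⟨A, B, hAB, fun τ hτ => ?_, fun τ hτ σ hσ => (hA τ hτ σ hσ).trans ?_⟩
  · have h1 := hB τ hτ
    have h2 : B τ + ε * ((a (i + 1) - a i) * A τ + (b (i + 1) - b i)) =
        B τ - ((ε * a i - ε * a (i + 1)) * A τ + (ε * b i - ε * b (i + 1))) := by ring
    rw [h2]
    refine h1.trans ?_
    rw [abs_mul, abs_mul, abs_of_pos hε]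
    calc (ε * |a i| + ε * |a (i + 1)|) * (2 * Real.pi * K * ε)
        ≤ (ε * T + ε * T) * (2 * Real.pi * K * ε) := by gcongr <;> exact haT _
      _ = 2 * Real.pi * K * (2 * T) * ε ^ 2 := by ring
      _ ≤ _ := by gcongr; linarith
  · have : 0 ≤ 2 * Real.pi * K * (2 * T) * ε := by positivity
    linarith

/-- Let `p i` be the abscissa of the intersection point of the `i`-th and the next line, and let
the difference of slopes be positive at `m` only. At the marked point `m` the flow is repelling in
backward time, so that boundedness alone forces a thin disk to be close to `p m` on the whole end,
hence on the compact part. This initial condition determines the disk on the other two ends. -/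
theorem exists_convergence_rate {a b p : Fin 3 → ℝ} {m : Fin 3} (M : ℝ)
    (hp : ∀ i, b (i + 1) - b i = -(a (i + 1) - a i) * p i)
    (hm : 0 < a (m + 1) - a m) (hneg : ∀ i, i ≠ m → a (i + 1) - a i < 0)
    {δ : ℝ} (hδ : 0 < δ) (hδ' : δ ≤ 1 / 2) :
    ∃ C, ∀ ε > 0, ∀ w, IsThinDisk a b M ε w →
      (∀ z ∈ compactPart δ, ‖w z - p m‖ ≤ C * ε) ∧
      ∀ i Φ, IsEndChart i δ Φ → ∀ τ : ℝ, τ ≤ 0 → ∀ σ ∈ Set.Icc (0 : ℝ) 1,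
        ‖w (Φ (τ + σ * Complex.I)) -
          ((p i + (p m - p i) * Real.exp (-(a (i + 1) - a i) * (ε * τ)) : ℝ) : ℂ)‖ ≤ C * ε := by
  obtain ⟨N, hN, hend⟩ := exists_end_average a b M
  obtain ⟨K, hK, hgrad⟩ := exists_norm_deriv_le a b M
  set l : Fin 3 → ℝ := fun i => a (i + 1) - a i with hl
  have hl0 : ∀ i, l i ≠ 0 := fun i => by
    rcases eq_or_ne i m with rfl | h
    · exact hm.ne'
    · exact (hneg i h).ne
  set S : ℝ := ∑ i, N / |l i| with hS
  have hS0 : 0 ≤ S := by positivity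
  have hlS : ∀ i, N / |l i| ≤ S := fun i =>
    Finset.single_le_sum (f := fun i => N / |l i|) (fun k _ => by positivity) (Finset.mem_univ i)
  have hflow : ∀ i {ε A B : ℝ},
      |B + ε * ((a (i + 1) - a i) * A + (b (i + 1) - b i))| ≤ N * ε ^ 2 →
      ∀ D D' : ℝ, D' + ε * l i * D = B + ε * l i * (A - p i) → |D' + ε * l i * D| ≤ N * ε ^ 2 := by
    intro i ε A B h D D' hDD
    rw [hDD]
    rw [hp] at h
    convert h using 2
    simp only [hl]
    ring
  have hre : ∀ (z : ℂ) (r : ℝ), ‖z - r‖ ≤ |z.re - r| + |z.im| := fun z r => by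
    simpa using Complex.norm_le_abs_re_add_abs_im (z - r)
  -- The bound on the `m`-th end, where no initial condition is needed.
  have hmid : ∀ ε > 0, ∀ w, IsThinDisk a b M ε w → ∀ Φ, IsEndChart m δ Φ →
      ∀ τ : ℝ, τ ≤ 0 → ∀ σ ∈ Set.Icc (0 : ℝ) 1,
        ‖w (Φ (τ + σ * Complex.I)) - p m‖ ≤ (N + S + |M|) * ε := by
    intro ε hε w hw Φ hΦ τ hτ σ hσ
    obtain ⟨A, B, hAB, hB, hA⟩ := hend ε hε w hw m δ Φ hΦ
    have hmem : ∀ τ : ℝ, ∀ σ ∈ Set.Icc (0 : ℝ) 1, Φ (τ + σ * Complex.I) ∈ closedHalfPlane :=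
      fun τ σ hσ => hΦ.mem_closed _ (by simpa using hσ.1) (by simpa using hσ.2)
    have hk : 0 < ε * l m := mul_pos hε hm
    have hbd : ∀ s : ℝ, s ≤ 0 → |A s - p m| ≤ M + N * ε + |p m| := by
      intro s hs
      have h1 := hA s hs 0 ⟨le_rfl, zero_le_one⟩
      have h2 := hw.abs_re_le _ (hmem s 0 ⟨le_rfl, zero_le_one⟩)
      have h3 := neg_abs_le (p m)
      have h4 := le_abs_self (p m)
      rw [abs_le] at h1 h2 ⊢
      constructor <;> linarith
    have hlim : Tendsto (fun t => Real.exp (ε * l m * t) * (A t - p m)) atBot (𝓝 0) := by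
      have hexp : Tendsto (fun t : ℝ => Real.exp (ε * l m * t)) atBot (𝓝 0) :=
        Real.tendsto_exp_atBot.comp (tendsto_id.const_mul_atBot hk)
      refine hexp.zero_mul_isBoundedUnder_le ?_
      refine ⟨M + N * ε + |p m|, ?_⟩
      rw [eventually_map]
      filter_upwards [eventually_le_atBot 0] with s hs using hbd s hs
    have h1 := abs_le_div_of_flow (D := fun t => A t - p m) (D' := B) (e := N * ε ^ 2) hk
      (fun t _ => ((hAB t).sub_const _).continuousAt.continuousWithinAt)
      (fun t _ => (hAB t).sub_const _)
      (fun t ht => hflow m (hB t ht.le) _ _ rfl) hlim hτ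
    have h2 : N * ε ^ 2 / (ε * l m) = N / |l m| * ε := by
      have := hl0 m
      rw [abs_of_pos (show 0 < l m from hm)]
      field_simp
    have h3 := hA τ hτ σ hσ
    have h4 := hw.abs_im_le _ (hmem τ σ hσ)
    have h5 := abs_sub_le (w (Φ (τ + σ * Complex.I))).re (A τ) (p m)
    have h6 := mul_le_mul_of_nonneg_right (hlS m) hε.le
    have h7 := mul_le_mul_of_nonneg_left (le_abs_self M) hε.le
    linarith [hre (w (Φ (τ + σ * Complex.I))) (p m)]
  set C₁ : ℝ := N + S + |M| + 2 * (K / δ * (2 * δ⁻¹)) with hC₁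
  have hthick : ∀ ε > 0, ∀ w, IsThinDisk a b M ε w → ∀ z ∈ compactPart δ,
      ‖w z - p m‖ ≤ C₁ * ε := by
    intro ε hε w hw z hz
    have hΦ := isEndChart_stripChart m hδ hδ'
    set Φ : ℂ → ℂ := fun s => stripChart (markedPoint m) δ (s.re, s.im) with hΦdef
    have h0 := hmid ε hε w hw Φ hΦ 0 le_rfl 0 ⟨le_rfl, zero_le_one⟩
    simp only [Complex.ofReal_zero, zero_mul, add_zero] at h0
    have hvar : ∀ u ∈ compactPart δ,
        ‖w u - w (δ⁻¹ * Complex.I)‖ ≤ K * ε / δ * (2 * δ⁻¹) := fun u hu =>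
      norm_sub_le_on_compactPart (by positivity) hδ hδ' hw.continuousOn hw.holomorphic
        (hgrad ε hε w hw) hu
    have h1 := hvar z hz
    have h2 := hvar _ hΦ.zero_mem
    rw [norm_sub_rev] at h2
    have h3 := norm_sub_le_norm_sub_add_norm_sub (w z) (w (δ⁻¹ * Complex.I)) (p m)
    have h4 := norm_sub_le_norm_sub_add_norm_sub (w (δ⁻¹ * Complex.I)) (w (Φ 0)) (p m)
    have h5 : K * ε / δ * (2 * δ⁻¹) = K / δ * (2 * δ⁻¹) * ε := by ring
    rw [h5] at h1 h2
    rw [hC₁]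
    linarith
  have hC₁0 : 0 ≤ C₁ := by positivity
  refine ⟨C₁ + 2 * N + S + |M|, fun ε hε w hw => ⟨fun z hz => ?_, fun i Φ hΦ τ hτ σ hσ => ?_⟩⟩
  · refine (hthick ε hε w hw z hz).trans ?_
    gcongr
    linarith [abs_nonneg M]
  rcases eq_or_ne i m with rfl | him
  · rw [sub_self, zero_mul, add_zero]
    refine (hmid ε hε w hw Φ hΦ τ hτ σ hσ).trans ?_
    gcongr
    linarith [abs_nonneg M]
  · obtain ⟨A, B, hAB, hB, hA⟩ := hend ε hε w hw i δ Φ hΦ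
    have hli : l i < 0 := hneg i him
    have hk : ε * l i < 0 := mul_neg_of_pos_of_neg hε hli
    set I : ℝ → ℝ := fun t => p i + (p m - p i) * Real.exp (-l i * (ε * t)) with hI
    have hId : ∀ t, HasDerivAt I ((p m - p i) * (Real.exp (-l i * (ε * t)) * (-l i * (ε * 1)))) t :=
      fun t => ((((hasDerivAt_id t).const_mul ε).const_mul (-l i)).exp.const_mul _).const_add _
    have h1 := abs_le_abs_zero_add_of_flow (D := fun t => A t - I t)
      (D' := fun t => B t - (p m - p i) * (Real.exp (-l i * (ε * t)) * (-l i * (ε * 1))))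
      (e := N * ε ^ 2) hk (by positivity)
      (fun t _ => ((hAB t).sub (hId t)).continuousAt.continuousWithinAt)
      (fun t _ => (hAB t).sub (hId t))
      (fun t ht => hflow i (hB t ht.le) _ _ (by simp only [hI]; ring)) hτ
    have hI0 : I 0 = p m := by simp [hI]
    have hA0 : |A 0 - I 0| ≤ N * ε + C₁ * ε := by
      rw [hI0]
      have h2 := hA 0 le_rfl 0 ⟨le_rfl, zero_le_one⟩
      have h3 := (Complex.abs_re_le_norm _).trans (hthick ε hε w hw _ hΦ.zero_mem)
      simp only [Complex.ofReal_zero, zero_mul, add_zero, Complex.sub_re, Complex.ofReal_re] at h2 h3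
      rw [abs_sub_comm] at h2
      linarith [abs_sub_le (A 0) (w (Φ 0)).re (p m)]
    have h2 : N * ε ^ 2 / |ε * l i| = N / |l i| * ε := by
      rw [abs_mul, abs_of_pos hε]
      have := abs_pos.2 (hl0 i)
      field_simp
    have h3 := hA τ hτ σ hσ
    have h4 := hw.abs_im_le _ (hΦ.mem_closed (τ + σ * Complex.I) (by simpa using hσ.1)
      (by simpa using hσ.2))
    have h5 := abs_sub_le (w (Φ (τ + σ * Complex.I))).re (A τ) (I τ)
    have h6 := mul_le_mul_of_nonneg_right (hlS i) hε.le
    have h7 := mul_le_mul_of_nonneg_left (le_abs_self M) hε.le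
    have h8 := hre (w (Φ (τ + σ * Complex.I))) (I τ)
    show ‖w (Φ (τ + σ * Complex.I)) - (I τ : ℝ)‖ ≤ _
    linarith

/-! ### The gradient tree -/

theorem Tripod.edge_zero (i : Fin 3) : Tripod.edge i 0 = Tripod.center :=
  Quotient.sound (Or.inr ⟨by simp, by simp⟩)

theorem Tripod.eq_vertex_or_eq_edge (x : Tripod) :
    (∃ i, x = Tripod.vertex i) ∨ ∃ i, ∃ t : ℝ, t ≤ 0 ∧ x = Tripod.edge i t := by
  induction x using Quotient.inductionOn with
  | h x =>
    obtain ⟨i, t, ht⟩ := x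
    rw [Set.mem_Iic] at ht
    induction t with
    | bot => exact Or.inl ⟨i, rfl⟩
    | top => simp at ht
    | coe t =>
      refine Or.inr ⟨i, t, by exact_mod_cast ht, ?_⟩
      have : min (t : EReal) 0 = t := min_eq_left ht
      simp only [Tripod.edge, this]
      rfl

theorem Tripod.continuous_mk_edge (i : Fin 3) : Continuous fun t : Set.Iic (0 : EReal) =>
    (Quotient.mk tripodSetoid (i, t) : Tripod) :=
  continuous_quotient_mk'.comp (Continuous.prodMk_right i)

/-- The external vertex is the limit of its edge at `-∞`. -/
theorem Tripod.tendsto_edge_atBot (i : Fin 3) :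
    Tendsto (Tripod.edge i) atBot (𝓝 (Tripod.vertex i)) := by
  refine ((Tripod.continuous_mk_edge i).tendsto ⟨⊥, Set.mem_Iic.2 bot_le⟩).comp ?_
  rw [tendsto_subtype_rng]
  have h : Tendsto (fun t : ℝ => min (t : EReal) 0) atBot (𝓝 (min ⊥ 0)) :=
    EReal.tendsto_coe_atBot.min tendsto_const_nhds
  simpa using h

/-- The map which is `p i + (q - p i) exp (|l i| t)` on the `i`-th edge of the tripod. The
exponential is extended to `[-∞, 0]` as a power of `EReal.exp t`, whose value at `-∞` is `0` if
`l i ≠ 0`. -/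
noncomputable def treeMap (p l : Fin 3 → ℝ) (q : ℝ) : Tripod → ℝ :=
  Quotient.lift (fun x : Fin 3 × Set.Iic (0 : EReal) =>
    p x.1 + (q - p x.1) * (EReal.exp (x.2 : EReal)).toReal ^ |l x.1|) (by
      rintro a b (rfl | ⟨h, h'⟩)
      · rfl
      · simp [h, h'])

theorem continuous_treeMap (p l : Fin 3 → ℝ) (q : ℝ) : Continuous (treeMap p l q) := by
  refine Continuous.quotient_lift ?_ _
  have hexp : Continuous fun t : Set.Iic (0 : EReal) => (EReal.exp (t : EReal)).toReal := by
    have h : ContinuousOn ENNReal.toReal {x | x ≠ ⊤} := ENNReal.continuousOn_toReal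
    refine h.comp_continuous (ENNReal.continuous_exp.comp continuous_subtype_val) fun t => ?_
    have h1 : EReal.exp (t : EReal) ≤ EReal.exp 0 := EReal.exp_monotone t.2
    rw [EReal.exp_zero] at h1
    exact (h1.trans_lt ENNReal.one_lt_top).ne
  refine continuous_prod_of_discrete_left.2 fun i => ?_
  show Continuous fun t : Set.Iic (0 : EReal) =>
    p i + (q - p i) * (EReal.exp (t : EReal)).toReal ^ |l i|
  exact continuous_const.add (continuous_const.mul
    (hexp.rpow_const fun _ => Or.inr (abs_nonneg _)))

theorem treeMap_vertex {p l : Fin 3 → ℝ} {q : ℝ} {i : Fin 3} (hl : l i ≠ 0) :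
    treeMap p l q (Tripod.vertex i) = p i := by
  show p i + (q - p i) * (EReal.exp ⊥).toReal ^ |l i| = p i
  simp [Real.zero_rpow (abs_ne_zero.2 hl)]

theorem treeMap_edge {p l : Fin 3 → ℝ} {q : ℝ} {i : Fin 3} (hl : l i < 0 ∨ q = p i) {t : ℝ}
    (ht : t ≤ 0) :
    treeMap p l q (Tripod.edge i t) = p i + (q - p i) * Real.exp (-l i * t) := by
  have hmin : min (t : EReal) 0 = t := min_eq_left (by exact_mod_cast ht)
  show p i + (q - p i) * (EReal.exp (min (t : EReal) 0)).toReal ^ |l i| = _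
  rcases hl with hl | hl
  · rw [hmin, EReal.exp_coe, ENNReal.toReal_ofReal (Real.exp_pos _).le, ← Real.exp_mul,
      abs_of_neg hl, mul_comm t]
  · simp [hl]

theorem isGradientTree_treeMap {f : Fin 3 → ℝ → ℝ} {p l : Fin 3 → ℝ} {q : ℝ}
    (hf : ∀ i t, deriv (fun u => f (i + 1) u - f i u) t = l i * (t - p i))
    (hl : ∀ i, l i ≠ 0) (hq : ∀ i, l i < 0 ∨ q = p i) :
    IsGradientTree f p (treeMap p l q) := by
  refine ⟨continuous_treeMap p l q, fun i => treeMap_vertex (hl i), fun i t ht => ?_⟩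
  have h1 : HasDerivAt (fun s => p i + (q - p i) * Real.exp (-l i * s))
      ((q - p i) * (Real.exp (-l i * t) * (-l i * 1))) t :=
    (((hasDerivAt_id t).const_mul (-l i)).exp.const_mul _).const_add _
  rw [hf, treeMap_edge (hq i) ht]
  refine (h1.hasDerivWithinAt.congr (fun s hs => treeMap_edge (hq i) hs)
    (treeMap_edge (hq i) ht)).congr_deriv ?_
  ring

/-- The edge along which the flow is repelling in backward time is mapped to a point, which fixes
the image of the interior vertex; the other edges are then solutions of initial value problems. -/
theorem IsGradientTree.eq_treeMap {f : Fin 3 → ℝ → ℝ} {p l : Fin 3 → ℝ} {m : Fin 3}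
    (hf : ∀ i t, deriv (fun u => f (i + 1) u - f i u) t = l i * (t - p i))
    (hm : 0 < l m) (hneg : ∀ i, i ≠ m → l i < 0) {J : Tripod → ℝ} (hJ : IsGradientTree f p J) :
    J = treeMap p l (p m) := by
  have hl : ∀ i, l i < 0 ∨ p m = p i := fun i => by
    rcases eq_or_ne i m with rfl | h
    · exact Or.inr rfl
    · exact Or.inl (hneg i h)
  have hl0 : ∀ i, l i ≠ 0 := fun i => by
    rcases eq_or_ne i m with rfl | h
    · exact hm.ne'
    · exact (hneg i h).ne
  have hI := isGradientTree_treeMap hf hl0 hl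
  set I := treeMap p l (p m)
  have hc : ∀ i, ContinuousOn (fun t => J (Tripod.edge i t) - I (Tripod.edge i t)) (Set.Iic 0) :=
    fun i t ht => ((hJ.flow i t ht).sub (hI.flow i t ht)).continuousWithinAt
  have hd : ∀ i, ∀ t < 0, HasDerivAt (fun t => J (Tripod.edge i t) - I (Tripod.edge i t))
      (-(l i * (J (Tripod.edge i t) - p i)) - -(l i * (I (Tripod.edge i t) - p i))) t := by
    intro i t ht
    have := ((hJ.flow i t ht.le).sub (hI.flow i t ht.le)).hasDerivAt (Iic_mem_nhds ht)
    rwa [hf, hf] at this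
  have hb : ∀ i, ∀ t < (0 : ℝ),
      |-(l i * (J (Tripod.edge i t) - p i)) - -(l i * (I (Tripod.edge i t) - p i)) +
        l i * (J (Tripod.edge i t) - I (Tripod.edge i t))| ≤ 0 := by
    intro i t _
    rw [abs_nonpos_iff]
    ring
  have hmid : ∀ t ≤ (0 : ℝ), J (Tripod.edge m t) = I (Tripod.edge m t) := by
    intro t ht
    have hlim : Tendsto (fun t => J (Tripod.edge m t) - I (Tripod.edge m t)) atBot (𝓝 0) := by
      have h1 := (hJ.continuous.tendsto _).comp (Tripod.tendsto_edge_atBot m)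
      have h2 := (hI.continuous.tendsto _).comp (Tripod.tendsto_edge_atBot m)
      simpa [hJ.map_vertex, hI.map_vertex] using h1.sub h2
    have hexp : Tendsto (fun t : ℝ => Real.exp (l m * t)) atBot (𝓝 0) :=
      Real.tendsto_exp_atBot.comp (tendsto_id.const_mul_atBot hm)
    have h := abs_le_div_of_flow hm (hc m) (hd m) (hb m) (by simpa using hexp.mul hlim) ht
    rw [zero_div, abs_nonpos_iff] at h
    exact sub_eq_zero.1 h
  have hcenter : J Tripod.center = I Tripod.center := by
    rw [← Tripod.edge_zero m]
    exact hmid 0 le_rfl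
  have hedge : ∀ i, ∀ t ≤ (0 : ℝ), J (Tripod.edge i t) = I (Tripod.edge i t) := by
    intro i t ht
    rcases eq_or_ne i m with rfl | him
    · exact hmid t ht
    · have h := abs_le_abs_zero_add_of_flow (hneg i him) le_rfl (hc i) (hd i) (hb i) ht
      rw [Tripod.edge_zero, hcenter, sub_self, abs_zero, zero_div, add_zero, abs_nonpos_iff] at h
      exact sub_eq_zero.1 h
  funext x
  rcases Tripod.eq_vertex_or_eq_edge x with ⟨i, rfl⟩ | ⟨i, t, ht, rfl⟩
  · rw [hJ.map_vertex, hI.map_vertex]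
  · exact hedge i t ht

/-! ### Triangles with sides on three lines -/

theorem sign_cases {u v w l₀ l₁ l₂ : ℝ} (hw : w = v - u) (c₀ : 0 < -(u * v) * l₀)
    (c₁ : 0 < u * w * l₁) (c₂ : 0 < -(v * w) * l₂) :
    (0 < l₀ ∧ l₁ < 0 ∧ l₂ < 0) ∨ (l₀ < 0 ∧ 0 < l₁ ∧ l₂ < 0) ∨ (l₀ < 0 ∧ l₁ < 0 ∧ 0 < l₂) := by
  rw [neg_mul, neg_pos] at c₀ c₂
  rcases mul_neg_iff.1 c₀ with ⟨h₀, k₀⟩ | ⟨h₀, k₀⟩ <;>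
    rcases mul_pos_iff.1 c₁ with ⟨h₁, k₁⟩ | ⟨h₁, k₁⟩ <;>
    rcases mul_neg_iff.1 c₂ with ⟨h₂, k₂⟩ | ⟨h₂, k₂⟩ <;>
    first
    | exact Or.inl ⟨k₀, k₁, k₂⟩
    | exact Or.inr (Or.inl ⟨k₀, k₁, k₂⟩)
    | exact Or.inr (Or.inr ⟨k₀, k₁, k₂⟩)
    -- The remaining sign patterns are incompatible with each other or with `w = v - u`.
    | exfalso
      simp only [mul_pos_iff, mul_neg_iff] at h₀ h₁ h₂
      rcases h₀ with ⟨_, _⟩ | ⟨_, _⟩ <;> rcases h₁ with ⟨_, _⟩ | ⟨_, _⟩ <;>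
        rcases h₂ with ⟨_, _⟩ | ⟨_, _⟩ <;> linarith

/-- Twice the signed area of the triangle is `-l i (p (i+1) - p i) (p (i+2) - p i)`, so that the
difference of slopes `l i` is positive exactly at the vertex lying between the other two. -/
theorem exists_pos_slope_difference {a b : Fin 3 → ℝ} {x : Fin 3 → ℂ}
    (h : ∀ i, (x i).im = a i * (x i).re + b i)
    (h' : ∀ i, (x i).im = a (i + 1) * (x i).re + b (i + 1)) (hccw : IsCounterclockwise x) :
    ∃ m, 0 < a (m + 1) - a m ∧ ∀ i, i ≠ m → a (i + 1) - a i < 0 := by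
  have e0 := h 0
  have e1 := h 1
  have e2 := h 2
  have e0' : (x 0).im = a 1 * (x 0).re + b 1 := h' 0
  have e1' : (x 1).im = a 2 * (x 1).re + b 2 := h' 1
  have e2' : (x 2).im = a 0 * (x 2).re + b 0 := h' 2
  set u := (x 1).re - (x 0).re with hu
  set v := (x 2).re - (x 0).re with hv
  set w := (x 2).re - (x 1).re with hw
  have hwuv : w = v - u := by rw [hu, hv, hw]; ring
  rw [IsCounterclockwise, Complex.sub_re, Complex.sub_re, Complex.sub_im, Complex.sub_im,
    ← hu, ← hv] at hccw
  have d10 : (x 1).im - (x 0).im = a 1 * u := by rw [e1, e0', hu]; ring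
  have d20 : (x 2).im - (x 0).im = a 0 * v := by rw [e2', e0, hv]; ring
  have d21 : (x 2).im - (x 1).im = a 2 * w := by rw [e2, e1', hw]; ring
  have d : a 2 * w = a 0 * v - a 1 * u := by rw [← d21, ← d20, ← d10]; ring
  rw [d10, d20] at hccw
  have c0 : 0 < -(u * v) * (a 1 - a 0) := by linarith
  have c1 : 0 < u * w * (a 2 - a 1) := by
    have : u * w * (a 2 - a 1) = u * (a 2 * w) - a 1 * u * w := by ring
    rw [this, d, hwuv]
    linarith
  have c2 : 0 < -(v * w) * (a 0 - a 2) := by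
    have : -(v * w) * (a 0 - a 2) = v * (a 2 * w) - a 0 * v * w := by ring
    rw [this, d, hwuv]
    linarith
  have hfin : ∀ {P : Fin 3 → Prop}, P 0 → P 1 → P 2 → ∀ i, P i := by
    intro P p0 p1 p2 i
    fin_cases i <;> assumption
  rcases sign_cases hwuv c0 c1 c2 with ⟨h0, h1, h2⟩ | ⟨h0, h1, h2⟩ | ⟨h0, h1, h2⟩
  · exact ⟨0, h0, hfin (fun h => absurd rfl h) (fun _ => h1) (fun _ => h2)⟩
  · exact ⟨1, h1, hfin (fun _ => h0) (fun h => absurd rfl h) (fun _ => h2)⟩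
  · exact ⟨2, h2, hfin (fun _ => h0) (fun _ => h1) (fun h => absurd rfl h)⟩

theorem isIndexZeroCriticalPoint_iff {f : Fin 3 → ℝ → ℝ} {p l : Fin 3 → ℝ} {m : Fin 3}
    (hf : ∀ i t, deriv (fun u => f (i + 1) u - f i u) t = l i * (t - p i))
    (hm : 0 < l m) (hneg : ∀ i, i ≠ m → l i < 0) (q : ℝ) :
    IsIndexZeroCriticalPoint f q ↔ q = p m := by
  have hder : ∀ i, deriv (deriv fun u => f (i + 1) u - f i u) q = l i := by
    intro i
    rw [show (deriv fun u => f (i + 1) u - f i u) = fun t => l i * (t - p i) from funext (hf i)]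
    simp
  constructor
  · rintro ⟨i, h1, h2⟩
    rw [morseIndex, hder] at h2
    have hi : i = m := by
      by_contra h
      simp [hneg i h] at h2
    subst hi
    rw [hf] at h1
    rcases mul_eq_zero.1 h1 with h | h
    · exact absurd h hm.ne'
    · linarith
  · rintro rfl
    refine ⟨m, by simp [hf], ?_⟩
    rw [morseIndex, hder, if_neg (not_lt.2 hm.le)]

theorem graphOneForm_injective : Function.Injective graphOneForm := fun η ζ h => by
  funext t
  have ht : (⟨t, η t⟩ : ℂ) ∈ graphOneForm ζ := h ▸ (rfl : η t = η t)
  exact ht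

/-- A Schwarz–Christoffel map onto a triangle whose vertices have imaginary part `O(ε)` is a thin
disk. -/
theorem IsSchwarzChristoffelMap.isThinDisk {a b : Fin 3 → ℝ} {M ε : ℝ} {η : Fin 3 → ℝ → ℝ}
    {x : Fin 3 → ℂ} {w : ℂ → ℂ} (hη : ∀ i t, η i t = ε * (a i * t + b i))
    (hre : ∀ i, |(x i).re| ≤ M) (him : ∀ i, |(x i).im| ≤ ε * M)
    (hw : IsSchwarzChristoffelMap (fun i => graphOneForm (η i)) x w) :
    IsThinDisk a b M ε w := by
  set box : Set ℂ := Set.Icc (-M) M ×ℂ Set.Icc (-(ε * M)) (ε * M) with hbox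
  have hclosed : IsClosed box := isClosed_Icc.reProdIm isClosed_Icc
  have hhull : convexHull ℝ (Set.range x) ⊆ box := by
    refine convexHull_min ?_ (((convex_Icc _ _).linear_preimage Complex.reLm).inter
      ((convex_Icc _ _).linear_preimage Complex.imLm))
    rintro _ ⟨i, rfl⟩
    exact ⟨abs_le.1 (hre i), abs_le.1 (him i)⟩
  have hcl : closure openHalfPlane = closedHalfPlane := Complex.closure_setOfPred_lt_im 0
  have hmaps : Set.MapsTo w closedHalfPlane box := by
    have h1 : Set.MapsTo w openHalfPlane box := fun z hz =>
      hhull (interior_subset (hw.bijOn.mapsTo hz))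
    have h2 := h1.closure_of_continuousOn (hcl ▸ hw.continuousOn)
    rwa [hcl, hclosed.closure_eq] at h2
  have hline : ∀ i t, w t ∈ graphOneForm (η i) → (w t).im = ε * (a i * (w t).re + b i) :=
    fun i t h => (show (w t).im = η i (w t).re from h).trans (hη i _)
  refine ⟨hw.continuousOn, hw.holomorphic, fun z hz => abs_le.2 (hmaps hz).1,
    fun z hz => abs_le.2 (hmaps hz).2, fun i t ht => ?_⟩
  fin_cases i
  · exact hline 0 t (hw.boundary_zero t ht.1 ht.2)
  · exact hline 1 t (hw.boundary_one t ht)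
  · exact hline 2 t (hw.boundary_two t ht)

theorem tendstoUniformlyOn_of_norm_sub_le {ι : Type*} {F : ℝ → ι → ℂ} {g : ι → ℂ} {s : Set ι}
    {C : ℝ} (h : ∀ ε > 0, ∀ z ∈ s, ‖F ε z - g z‖ ≤ C * ε) :
    TendstoUniformlyOn F g (𝓝[>] 0) s := by
  rw [Metric.tendstoUniformlyOn_iff]
  intro e he
  have h1 : Tendsto (fun ε : ℝ => C * ε) (𝓝[>] 0) (𝓝 0) := by
    have := ((continuous_const_mul C).tendsto 0).mono_left
      (nhdsWithin_le_nhds (s := Set.Ioi (0 : ℝ)))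
    rwa [mul_zero] at this
  filter_upwards [h1.eventually (gt_mem_nhds he), self_mem_nhdsWithin] with ε hε hε0 z hz
  rw [dist_comm, dist_eq_norm]
  exact (h ε hε0 z hz).trans_lt hε

end TriangleDisk


theorem theorem3p1
    (L : Fin 3 → Set ℂ) (f : Fin 3 → ℝ → ℝ) (x : Fin 3 → ℂ)
    -- three affine Lagrangian sections, pairwise intersecting and pairwise distinct
    (hL : ∀ i, TriangleDisk.IsAffineSection (L i))
    (hLne : ∀ i j, i ≠ j → (L i ∩ L j).Nonempty)
    (hLdist : ∀ i, L i ≠ L (i + 1))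
    (hf : ∀ i, Differentiable ℝ (f i))
    (hLf : ∀ i, L i = TriangleDisk.graphOneForm (deriv (f i)))
    -- their intersection points form a counterclockwise triangle
    (hx : ∀ i, x i ∈ L i ∩ L (i + 1))
    (hccw : TriangleDisk.IsCounterclockwise x) :
    ∃ (p₀ : ℝ) (I : TriangleDisk.Tripod → ℝ),
      -- the unique critical point of Morse index zero
      (TriangleDisk.IsIndexZeroCriticalPoint f p₀ ∧
        ∀ p, TriangleDisk.IsIndexZeroCriticalPoint f p → p = p₀) ∧
      -- the unique gradient tree, and the image of its interior vertex
      (TriangleDisk.IsGradientTree f (fun i => (x i).re) I ∧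
        ∀ J, TriangleDisk.IsGradientTree f (fun i => (x i).re) J → J = I) ∧
      I TriangleDisk.Tripod.center = p₀ ∧
      -- convergence of the Schwarz-Christoffel maps
      ∀ (xε : ℝ → Fin 3 → ℂ) (w : ℝ → ℂ → ℂ),
        (∀ ε > 0, ∀ i, xε ε i ∈
          TriangleDisk.graphOneForm (fun t => ε * deriv (f i) t) ∩
            TriangleDisk.graphOneForm (fun t => ε * deriv (f (i + 1)) t)) →
        (∀ ε > 0, TriangleDisk.IsSchwarzChristoffelMap
          (fun i => TriangleDisk.graphOneForm (fun t => ε * deriv (f i) t)) (xε ε) (w ε)) →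
        ∀ δ > 0,
          (∀ i j, i ≠ j → Disjoint (TriangleDisk.halfDisk (TriangleDisk.markedPoint i) δ)
            (TriangleDisk.halfDisk (TriangleDisk.markedPoint j) δ)) →
          TendstoUniformlyOn w (fun _ => (p₀ : ℂ)) (𝓝[>] 0) (TriangleDisk.thickPart δ) ∧
          ∀ i, TendstoUniformlyOn
            (fun (ε : ℝ) (q : ℝ × ℝ) =>
              w ε (TriangleDisk.stripChart (TriangleDisk.markedPoint i) δ q) -
                (I (TriangleDisk.Tripod.edge i (ε * q.1)) : ℂ))
            (fun _ => (0 : ℂ)) (𝓝[>] 0) TriangleDisk.strip := by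
  choose a b hab using hL
  have hderiv : ∀ i t, deriv (f i) t = a i * t + b i := fun i t =>
    congrFun (TriangleDisk.graphOneForm_injective ((hLf i).symm.trans (hab i))) t
  set p : Fin 3 → ℝ := fun i => (x i).re with hp
  set y : Fin 3 → ℝ := fun i => a i * p i + b i with hy
  have him : ∀ i, (x i).im = a i * (x i).re + b i := fun i => by
    have h : x i ∈ TriangleDisk.graphOneForm _ := hab i ▸ (hx i).1
    exact h
  have him' : ∀ i, (x i).im = a (i + 1) * (x i).re + b (i + 1) := fun i => by
    have h : x i ∈ TriangleDisk.graphOneForm _ := hab (i + 1) ▸ (hx i).2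
    exact h
  have hb : ∀ i, b (i + 1) - b i = -(a (i + 1) - a i) * p i := fun i => by
    have := (him i).symm.trans (him' i)
    simp only [hp]
    linarith
  obtain ⟨m, hm, hneg⟩ := TriangleDisk.exists_pos_slope_difference him him' hccw
  set l : Fin 3 → ℝ := fun i => a (i + 1) - a i with hl
  have hdiff : ∀ i t, deriv (fun u => f (i + 1) u - f i u) t = l i * (t - p i) := by
    intro i t
    rw [deriv_fun_sub (hf (i + 1) t) (hf i t), hderiv, hderiv]
    linarith [hb i]
  have hlm : ∀ i, l i < 0 ∨ p m = p i := fun i => by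
    rcases eq_or_ne i m with rfl | h
    · exact Or.inr rfl
    · exact Or.inl (hneg i h)
  have hl0 : ∀ i, l i ≠ 0 := fun i => by
    rcases eq_or_ne i m with rfl | h
    · exact hm.ne'
    · exact (hneg i h).ne
  have hcrit := TriangleDisk.isIndexZeroCriticalPoint_iff hdiff hm hneg
  refine ⟨p m, TriangleDisk.treeMap p l (p m), ⟨(hcrit _).2 rfl, fun q hq => (hcrit q).1 hq⟩,
    ⟨TriangleDisk.isGradientTree_treeMap hdiff hl0 hlm, fun J hJ => hJ.eq_treeMap hdiff hm hneg⟩,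
    ?_, ?_⟩
  · rw [← TriangleDisk.Tripod.edge_zero m, TriangleDisk.treeMap_edge (hlm m) le_rfl]
    simp
  intro xε w hxε hw δ hδ hdisj
  have hδ' := TriangleDisk.le_half_of_disjoint_halfDisk hdisj
  set M : ℝ := ∑ i, (|p i| + |y i|) with hM
  have hMi : ∀ i, |p i| + |y i| ≤ M := fun i =>
    Finset.single_le_sum (f := fun i => |p i| + |y i|) (fun j _ => by positivity)
      (Finset.mem_univ i)
  have hthin : ∀ ε > 0, TriangleDisk.IsThinDisk a b M ε (w ε) := by
    intro ε hε
    have hxim : ∀ i, (xε ε i).im = ε * (a i * (xε ε i).re + b i) := fun i => by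
      have h : (xε ε i).im = ε * deriv (f i) (xε ε i).re := (hxε ε hε i).1
      rwa [hderiv] at h
    have hxre : ∀ i, (xε ε i).re = p i := fun i => by
      have h : (xε ε i).im = ε * deriv (f (i + 1)) (xε ε i).re := (hxε ε hε i).2
      rw [hderiv] at h
      have h1 := mul_left_cancel₀ hε.ne' ((hxim i).symm.trans h)
      have h2 : l i * ((xε ε i).re - p i) = 0 := by
        have := hb i
        simp only [hl]
        linarith
      rcases mul_eq_zero.1 h2 with h3 | h3
      · exact absurd h3 (hl0 i)
      · linarith
    refine (hw ε hε).isThinDisk (fun i t => by rw [hderiv]) (fun i => ?_) fun i => ?_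
    · rw [hxre]
      linarith [hMi i, abs_nonneg (y i)]
    · rw [hxim, hxre, abs_mul, abs_of_pos hε]
      have h1 : |a i * p i + b i| ≤ M := by
        have := hMi i
        simp only [hy] at this
        linarith [abs_nonneg (p i)]
      exact mul_le_mul_of_nonneg_left h1 hε.le
  obtain ⟨C, hC⟩ := TriangleDisk.exists_convergence_rate M hb hm hneg hδ hδ'
  refine ⟨TriangleDisk.tendstoUniformlyOn_of_norm_sub_le (C := C) fun ε hε z hz =>
    (hC ε hε _ (hthin ε hε)).1 z (TriangleDisk.thickPart_subset_compactPart δ hz), fun i =>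
    TriangleDisk.tendstoUniformlyOn_of_norm_sub_le (C := C) ?_⟩
  rintro ε hε ⟨τ, σ⟩ ⟨hτ, hσ⟩
  have hτ' : τ < 0 := hτ
  have h := (hC ε hε _ (hthin ε hε)).2 i _ (TriangleDisk.isEndChart_stripChart i hδ hδ') τ hτ'.le
    σ hσ
  have h1 : ((τ : ℂ) + σ * Complex.I).re = τ := by simp
  have h2 : ((τ : ℂ) + σ * Complex.I).im = σ := by simp
  rw [h1, h2] at h
  rw [TriangleDisk.treeMap_edge (hlm i) (mul_nonpos_of_nonneg_of_nonpos hε.le hτ'.le), sub_zero]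
  exact h
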